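/- Let $W_1,W_2,\overline W$ be separable real Hilbert spaces with a dense linear inclusion $W_1\subset\overline W$, and let $A:W_1\to W_2$ be linear, bounded and injective, with adjoint $A^*:W_2\to W_1$. Suppose that $A$ extends to a bounded operator $A:\overline W\to W_2$, with $\|Af\|_{W_2}\le c\|f\|_{\overline W}$ for all $f\in\overline W$ and some $c>0$. Let $\mathbb W=(\mathbb W(\varphi):\varphi\in W_2)$ be a centred Gaussian white noise process on a probability space $(\Omega,\Sigma,\mathbb P)$, $\mathbb E[\mathbb W(\varphi)\mathbb W(\chi)]=\langle\varphi,\chi\rangle_{W_2}$. For $\varepsilon>0$ and $f\in\overline W$ let $P_f^M$ be the (cylindrical) law on $\mathbb R^{W_2}$ of the observation $M_\varepsilon=Af+\varepsilon\mathbb W$, i.e. $M_\varepsilon(\varphi)=\langle Af,\varphi\rangle_{W_2}+\varepsilon\mathbb W(\varphi)$. Let $\Pi$ be a centred Gaussian Borel probability measure on $\overline W$ with reproducing kernel Hilbert (Cameron–Martin) space $V_\Pi$, let $f^\dagger\in\overline W$, and for $\delta>0$ put $$\phi_{\Pi,f^\dagger}(\delta)=\inf_{g\in V_\Pi,\ \|g-f^\dagger\|_{\overline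 W}\le\delta}\frac{\|g\|_{V_\Pi}^2}{2}-\log\Pi\big(f:\|f\|_{\overline W}\le\delta\big).$$ Assume that there are $\delta_\varepsilon\to0$ with $\delta_\varepsilon/\varepsilon\to\infty$ as $\varepsilon\to0$ such that $\phi_{\Pi,f^\dagger}(\delta_\varepsilon/(2c))\le(\delta_\varepsilon/\varepsilon)^2$ for all sufficiently small $\varepsilon>0$. Let $\psi\in W_1$ be such that for some constant $C$ one has $|\langle\psi,\varphi\rangle_{W_1}|\le C\|\varphi\|_{\overline W}$ for all $\varphi\in W_1$, so that $\langle\cdot,\psi\rangle_{W_1}$ extends continuously to $\overline W$ (the extension is denoted in the same way), and suppose that $\psi=-A^*A\widetilde\psi$ for some $\widetilde\psi\in V_\Pi$. Put $$\widehat\Psi=\langle f^\dagger,\psi\rangle_{W_1}-\varepsilon\,\mathbb W(A\widetilde\psi).$$ For every $\varepsilon>0$ there is a version $p_f(m)$ of the density $dP_f^M/dP_0^M(m)$, $f\in\overline W$, that is jointly measurable in $(f,m)$. For any choice of such versions, let $$\Pi(B\mid m)=\frac{\int_B p_f(m)\,d\Pi(f)}{\int_{\overline W}p_f(m)\,d\Pi(f)}$$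 be the posterior, and let $M_\varepsilon=Af^\dagger+\varepsilon\mathbb W$ be generated from the true parameter $f^\dagger$. Then, for every $\varepsilon>0$, $\Pi(\cdot\mid M_\varepsilon)$ is almost surely a probability measure with integrable norm, so that its mean $\bar f=\mathbb E^\Pi[f\mid M_\varepsilon]\in\overline W$ exists, and $$\varepsilon^{-1}\big(\langle\bar f,\psi\rangle_{W_1}-\widehat\Psi\big)\to0\quad\text{in probability as }\varepsilon\to0.$$ Moreover $$\mathcal L\big(\varepsilon^{-1}\langle f-\bar f,\psi\rangle_{W_1}\,\big|\,M_\varepsilon\big)\to\mathcal N\big(0,\|A\widetilde\psi\|_{W_2}^2\big)$$ weakly in probability as $\varepsilon\to0$, where $f\mid M_\varepsilon\sim\Pi(\cdot\mid M_\varepsilon)$; that is, for every metric $d$ for weak convergence of probability measures on $\mathbb R$, the distance $d$ between the two laws tends to $0$ in probability. -/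

import Mathlib

open MeasureTheory ProbabilityTheory Filter Topology
open scoped ENNReal NNReal RealInnerProductSpace

noncomputable section

namespace LinearInverseProblem

/-- `𝕎` is a centred Gaussian white noise process indexed by the Hilbert space `H`: a centred
Gaussian process of random variables with `𝔼[𝕎 φ * 𝕎 χ] = ⟪φ, χ⟫`. -/
structure IsWhiteNoise {H Ω : Type*} [NormedAddCommGroup H] [InnerProductSpace ℝ H]
    [MeasurableSpace Ω] (𝕎 : H → Ω → ℝ) (P : Measure Ω) : Prop where
  measurable : ∀ φ, Measurable (𝕎 φ)
  isGaussianProcess : IsGaussianProcess 𝕎 P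
  centred : ∀ φ, ∫ ω, 𝕎 φ ω ∂P = 0
  covariance : ∀ φ χ, ∫ ω, 𝕎 φ ω * 𝕎 χ ω ∂P = ⟪φ, χ⟫

section Model

variable {Wbar W₂ Ω : Type*} [NormedAddCommGroup Wbar] [InnerProductSpace ℝ Wbar]
  [NormedAddCommGroup W₂] [InnerProductSpace ℝ W₂]

/-- The observation `M = A f + ε 𝕎`, a process indexed by `W₂`:
`M φ = ⟪A f, φ⟫ + ε 𝕎 φ`. -/
def observation (A : Wbar →L[ℝ] W₂) (𝕎 : W₂ → Ω → ℝ) (ε : ℝ) (f : Wbar) (ω : Ω) : W₂ → ℝ :=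
  fun φ => ⟪A f, φ⟫ + ε * 𝕎 φ ω

/-- The (cylindrical) law of the observation, a measure on `W₂ → ℝ` with its product
`σ`-algebra. -/
def observationLaw [MeasurableSpace Ω] (P : Measure Ω) (A : Wbar →L[ℝ] W₂) (𝕎 : W₂ → Ω → ℝ)
    (ε : ℝ) (f : Wbar) : Measure (W₂ → ℝ) :=
  P.map (observation A 𝕎 ε f)

/-- `p` is a jointly measurable version of the likelihood: for every parameter `f`, the function
`p f` is a density of the law of the observation under `f` with respect to the law under `0`,
which is the law of `ε 𝕎`. -/
structure IsLikelihood [MeasurableSpace Wbar] [MeasurableSpace Ω] (P : Measure Ω)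
    (A : Wbar →L[ℝ] W₂) (𝕎 : W₂ → Ω → ℝ) (ε : ℝ) (p : Wbar → (W₂ → ℝ) → ℝ≥0∞) : Prop where
  measurable : Measurable (Function.uncurry p)
  density : ∀ f, observationLaw P A 𝕎 ε f = (observationLaw P A 𝕎 ε 0).withDensity (p f)

/-- Bayes' formula: `Π(B | m) = (∫_B p_f(m) dΠ(f)) / (∫ p_f(m) dΠ(f))`. -/
def bayesPosterior [MeasurableSpace Wbar] (prior : Measure Wbar)
    (p : Wbar → (W₂ → ℝ) → ℝ≥0∞) (m : W₂ → ℝ) : Measure Wbar :=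
  (∫⁻ f, p f m ∂prior)⁻¹ • prior.withDensity (fun f => p f m)

/-- The posterior mean, as a Bochner integral. -/
def posteriorMean [MeasurableSpace Wbar] (prior : Measure Wbar)
    (p : Wbar → (W₂ → ℝ) → ℝ≥0∞) (m : W₂ → ℝ) : Wbar :=
  ∫ f, f ∂(bayesPosterior prior p m)

end Model

section CameronMartin

variable {E : Type*} [NormedAddCommGroup E] [InnerProductSpace ℝ E] [MeasurableSpace E]

/-- The norm of the Cameron-Martin space (RKHS) of a centred Gaussian measure `μ`:
`|h| = sup {l h : l a continuous linear functional with ‖l‖_{L²(μ)} ≤ 1}`,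
which is infinite for `h` outside the space. -/
def rkhsNorm (μ : Measure E) (h : E) : ℝ≥0∞ :=
  ⨆ (l : StrongDual ℝ E) (_ : eLpNorm l 2 μ ≤ 1), ENNReal.ofReal (l h)

/-- The Cameron-Martin space (RKHS) of a centred Gaussian measure. -/
def rkhs (μ : Measure E) : Set E := {h | rkhsNorm μ h < ∞}

/-- The concentration function
`inf {|g|² / 2 : g ∈ V, ‖g - f₀‖ ≤ δ} - log μ {f : ‖f‖ ≤ δ}` of `μ` at `f₀`, where `V` is the RKHS
(extended-real valued; the infimum of the empty set is `∞`). -/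
def concentrationFunction (μ : Measure E) (f₀ : E) (δ : ℝ) : EReal :=
  ((⨅ (g : E) (_ : g ∈ rkhs μ ∧ ‖g - f₀‖ ≤ δ), rkhsNorm μ g ^ 2 / 2 : ℝ≥0∞) : EReal)
    - ENNReal.log (μ {f | ‖f‖ ≤ δ})

/-- The concentration condition with constant `c`: there are `δ_ε → 0` with `δ_ε / ε → ∞`
as `ε → 0` for which the concentration function at `δ_ε / (2 c)` is at most `(δ_ε / ε)²`. -/
def ConcentrationCondition (μ : Measure E) (f₀ : E) (c : ℝ) : Prop :=
  ∃ δ : ℝ → ℝ, Tendsto δ (𝓝[>] 0) (𝓝 0) ∧ Tendsto (fun ε => δ ε / ε) (𝓝[>] 0) atTop ∧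
    ∀ᶠ ε in 𝓝[>] (0 : ℝ),
      concentrationFunction μ f₀ (δ ε / (2 * c)) ≤ (((δ ε / ε) ^ 2 : ℝ) : EReal)

end CameronMartin

/-- The continuous extension to `Wbar` of the functional `φ ↦ ⟪ψ, φ⟫` on `W₁`, along a linear
inclusion `ι : W₁ → Wbar` with dense range for which `|⟪ψ, φ⟫| ≤ C ‖ι φ‖`. -/
def extendedPairing {W₁ Wbar : Type*} [NormedAddCommGroup W₁] [InnerProductSpace ℝ W₁]
    [NormedAddCommGroup Wbar] [InnerProductSpace ℝ Wbar] (ι : W₁ →ₗ[ℝ] Wbar) (ψ : W₁) :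
    Wbar →L[ℝ] ℝ :=
  LinearMap.extendOfNorm (innerSL ℝ ψ).toLinearMap ι

/-- The topology of weak convergence on the probability measures on `ℝ`. -/
abbrev weakTopology : TopologicalSpace (ProbabilityMeasure ℝ) := inferInstance

/-- Weak convergence in probability of the random laws `μ ε` to `ν`: for every metric `d` on the
probability measures that induces the weak topology, `d (μ ε) ν → 0` in `P`-probability. A point
`ω` at which `μ ε ω` is not a probability measure counts as one at which the distance is large. -/
def TendstoWeaklyInProbability {Ω : Type*} [MeasurableSpace Ω] (P : Measure Ω)
    (μ : ℝ → Ω → Measure ℝ) (l : Filter ℝ) (ν : ProbabilityMeasure ℝ) : Prop :=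
  ∀ d : MetricSpace (ProbabilityMeasure ℝ),
    d.toPseudoMetricSpace.toUniformSpace.toTopologicalSpace = weakTopology →
    ∀ r > (0 : ℝ), Tendsto
      (fun ε => P {ω | ∀ h : IsProbabilityMeasure (μ ε ω), r ≤ d.dist ⟨μ ε ω, h⟩ ν}) l (𝓝 0)

end LinearInverseProblem

end

noncomputable section

namespace LinearInverseProblem

/-! The model is conjugate, so the posterior law of the functional `L = ⟨·, ψ⟩` can be computed
exactly. Write `u = A ψ̃`, so that `L f = -⟪A f, u⟫`, and let `S` be the covariance operator of `A
f` under the prior. Solve `S x + ε² x = u` and put `v = u - ε² x = S x`. When `f` is drawn from the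
prior, `L f + M v` is uncorrelated with every coordinate of `M`, hence independent of `M` by joint
Gaussianity. Given `M`, it therefore keeps its unconditional centred Gaussian law: the posterior
mean of `L` is `-M v`, and the rescaled, centred posterior is the nonrandom law `N(0, ε² ⟪S x, x⟫ +
‖v‖²)` (`ae_posterior_functional`). These statements hold almost surely under the law of pure noise,
and transfer to the truth `f₀` by absolute continuity.

It remains to let `ε → 0`. Since `ψ̃` lies in the RKHS, `|⟪u, x⟫| ≤ K √⟪S x, x⟫`, and pairing the
resolvent equation with `x` bounds both `√⟪S x, x⟫` and `ε ‖x‖` by `K` (`resolvent_bounds`). Hence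
`v → u` and the variance tends to `‖u‖²`. The centring error is `ε ⟪A f₀, x⟫ + 𝕎 u - 𝕎 v`: the noise
part vanishes in `L²`, and the bias vanishes by replacing `f₀` with an RKHS element supplied by the
concentration condition (`tendsto_bias`). -/

lemma gaussianReal_mul_var_eq_withDensity (a : ℝ) (v : ℝ≥0) :
    gaussianReal (a * v) v =
      (gaussianReal 0 v).withDensity
        (fun x => ENNReal.ofReal (Real.exp (a * x - a ^ 2 * v / 2))) := by
  by_cases hv : v = 0
  · subst hv
    simp only [NNReal.coe_zero, mul_zero, gaussianReal_zero_var]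
    ext s hs
    rw [withDensity_apply _ hs, Measure.dirac_apply' _ hs, ← lintegral_indicator hs,
      lintegral_dirac' _ (by fun_prop (disch := exact hs))]
    by_cases h0 : (0 : ℝ) ∈ s <;> simp [h0]
  · rw [gaussianReal_of_var_ne_zero _ hv, gaussianReal_of_var_ne_zero _ hv,
      ← withDensity_mul _ (measurable_gaussianPDF _ _) (by fun_prop)]
    congr 1
    ext x
    have hv' : (v : ℝ) ≠ 0 := by exact_mod_cast hv
    simp only [Pi.mul_apply, gaussianPDF]
    rw [← ENNReal.ofReal_mul (gaussianPDFReal_nonneg _ _ _), gaussianPDFReal, gaussianPDFReal,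
      mul_assoc _ (Real.exp _) (Real.exp _), ← Real.exp_add]
    congr 3
    field_simp
    ring

/-! ### White noise: Cameron–Martin shift and measurable versions -/

section WhiteNoise

variable {H Ω : Type*} [NormedAddCommGroup H] [InnerProductSpace ℝ H] [MeasurableSpace Ω]
  {P : Measure Ω} {𝕎 : H → Ω → ℝ}

namespace IsWhiteNoise

lemma memLp_two (h : IsWhiteNoise 𝕎 P) (φ : H) : MemLp (𝕎 φ) 2 P :=
  ((IsWhiteNoise.isGaussianProcess h).hasGaussianLaw_eval φ).memLp_two

lemma cov_eq [IsProbabilityMeasure P] (h : IsWhiteNoise 𝕎 P) (φ χ : H) :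
    cov[𝕎 φ, 𝕎 χ; P] = ⟪φ, χ⟫ := by
  rw [covariance_eq_sub (h.memLp_two φ) (h.memLp_two χ), h.centred, h.centred, zero_mul, sub_zero,
    ← h.covariance]
  rfl

lemma map_eq_gaussianReal [IsProbabilityMeasure P] (h : IsWhiteNoise 𝕎 P) (φ : H) :
    P.map (𝕎 φ) = gaussianReal 0 (‖φ‖₊ ^ 2) := by
  rw [((IsWhiteNoise.isGaussianProcess h).hasGaussianLaw_eval φ).map_eq_gaussianReal, h.centred,
    ← covariance_self (h.measurable φ).aemeasurable, h.cov_eq, real_inner_self_eq_norm_sq]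
  congr 1
  ext
  simp

lemma lintegral_sub_sq [IsProbabilityMeasure P] (h : IsWhiteNoise 𝕎 P) (φ χ : H) :
    ∫⁻ ω, ENNReal.ofReal ((𝕎 φ ω - 𝕎 χ ω) ^ 2) ∂P = ENNReal.ofReal (‖φ - χ‖ ^ 2) := by
  have hφ := h.memLp_two φ
  have hχ := h.memLp_two χ
  have hint : Integrable (fun ω => (𝕎 φ ω - 𝕎 χ ω) ^ 2) P := (hφ.sub hχ).integrable_sq
  rw [← ofReal_integral_eq_lintegral_ofReal hint (ae_of_all _ fun _ => sq_nonneg _)]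
  congr 1
  have e : (fun ω => (𝕎 φ ω - 𝕎 χ ω) ^ 2)
      = fun ω => 𝕎 φ ω * 𝕎 φ ω - 2 * (𝕎 φ ω * 𝕎 χ ω) + 𝕎 χ ω * 𝕎 χ ω := by
    ext ω; ring
  have i1 : Integrable (fun ω => 𝕎 φ ω * 𝕎 φ ω) P := hφ.integrable_mul hφ
  have i2 : Integrable (fun ω => 𝕎 φ ω * 𝕎 χ ω) P := hφ.integrable_mul hχ
  have i3 : Integrable (fun ω => 𝕎 χ ω * 𝕎 χ ω) P := hχ.integrable_mul hχ
  have i4 : Integrable (fun ω => 𝕎 φ ω * 𝕎 φ ω - 2 * (𝕎 φ ω * 𝕎 χ ω)) P := i1.sub (i2.const_mul 2)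
  rw [e, integral_add i4 i3, integral_sub i1 (i2.const_mul 2),
    integral_const_mul, h.covariance, h.covariance, h.covariance, norm_sub_sq_real,
    real_inner_self_eq_norm_sq, real_inner_self_eq_norm_sq]

/-- The Cameron-Martin formula for white noise. -/
lemma lintegral_shift [IsProbabilityMeasure P] (h : IsWhiteNoise 𝕎 P) {ε : ℝ} (hε : 0 < ε)
    (g : H) {G : (H → ℝ) → ℝ≥0∞} (hG : Measurable G) :
    ∫⁻ ω, G (fun φ => ⟪g, φ⟫ + ε * 𝕎 φ ω) ∂P =
      ∫⁻ ω, G (fun φ => ε * 𝕎 φ ω) *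
        ENNReal.ofReal (Real.exp (ε⁻¹ * 𝕎 g ω - (ε⁻¹) ^ 2 * ‖g‖ ^ 2 / 2)) ∂P := by
  -- Regress on `𝕎 g`: the residuals `R φ = 𝕎 φ - k φ * 𝕎 g` are independent of `𝕎 g`, so shifting
  -- the whole process along `g` amounts to shifting one real Gaussian variable by `ε⁻¹ ‖g‖²`. For
  -- `g = 0` the division gives `k = 0`, which is the correct value.
  set k : H → ℝ := fun φ => ⟪g, φ⟫ / ‖g‖ ^ 2 with hk
  have hkg (φ : H) : k φ * ‖g‖ ^ 2 = ⟪g, φ⟫ := by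
    by_cases hg : g = 0
    · simp [hg]
    · have : ‖g‖ ≠ 0 := by simpa using hg
      simp only [hk]
      field_simp
  set R : H → Ω → ℝ := fun φ ω => 𝕎 φ ω - k φ * 𝕎 g ω with hR
  have mR : Measurable (fun ω φ => R φ ω) := by
    refine measurable_pi_lambda _ fun φ => ?_
    exact (h.measurable φ).sub ((h.measurable g).const_mul _)
  have hgauss : IsGaussianProcess (Sum.elim (fun _ : Unit => 𝕎 g) R) P := by
    classical
    refine IsGaussianProcess.of_isGaussianProcess (IsWhiteNoise.isGaussianProcess h) fun s => ?_
    rcases s with _ | φ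
    · exact ⟨{g}, ContinuousLinearMap.proj ⟨g, by simp⟩, fun ω => by simp⟩
    · refine ⟨{φ, g}, ContinuousLinearMap.proj (R := ℝ) (φ := fun _ => ℝ) ⟨φ, by simp⟩
        - k φ • ContinuousLinearMap.proj (R := ℝ) (φ := fun _ => ℝ) ⟨g, by simp⟩, fun ω => ?_⟩
      simp [hR]
  have hind := hgauss.indepFun_of_covariance_eq_zero
    (fun _ => (h.measurable g).aemeasurable)
    (fun φ => ((measurable_pi_apply φ).comp mR).aemeasurable) (fun _ φ => by
      have e : R φ = 𝕎 φ - fun ω => k φ * 𝕎 g ω := rfl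
      rw [e, covariance_sub_right (h.memLp_two g) (h.memLp_two φ) ((h.memLp_two g).const_mul _),
        covariance_const_mul_right, h.cov_eq, h.cov_eq, real_inner_self_eq_norm_sq, hkg, sub_self])
  have hind' : IndepFun (𝕎 g) (fun ω φ => R φ ω) P :=
    hind.comp (measurable_pi_apply ()) measurable_id
  have hlaw : P.map (fun ω => (𝕎 g ω, fun φ => R φ ω))
      = (gaussianReal 0 (‖g‖₊ ^ 2)).prod (P.map (fun ω φ => R φ ω)) := by
    rw [← h.map_eq_gaussianReal g]
    exact (indepFun_iff_map_prod_eq_prod_map_map (h.measurable g).aemeasurable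
      mR.aemeasurable).1 hind'
  have : IsProbabilityMeasure (P.map (fun ω φ => R φ ω)) :=
    Measure.isProbabilityMeasure_map mR.aemeasurable
  set Φ : ℝ × (H → ℝ) → H → ℝ := fun z φ => ε * (z.2 φ + k φ * z.1) with hΦ
  have mΦ : Measurable Φ := by
    refine measurable_pi_lambda _ fun φ => ?_
    have : Measurable fun z : ℝ × (H → ℝ) => z.2 φ := (measurable_pi_apply φ).comp measurable_snd
    simp only [hΦ]
    fun_prop
  set a : ℝ := ε⁻¹ with ha
  set D : ℝ → ℝ≥0∞ := fun x => ENNReal.ofReal (Real.exp (a * x - a ^ 2 * ‖g‖ ^ 2 / 2)) with hD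
  have mD : Measurable D := by fun_prop
  have mpair : Measurable (fun ω => (𝕎 g ω, fun φ => R φ ω)) := (h.measurable g).prodMk mR
  have hcoe : ((‖g‖₊ ^ 2 : ℝ≥0) : ℝ) = ‖g‖ ^ 2 := by simp
  have hcm := gaussianReal_mul_var_eq_withDensity a (‖g‖₊ ^ 2)
  rw [hcoe] at hcm
  have hshift : (gaussianReal 0 (‖g‖₊ ^ 2)).map (· + a * ‖g‖ ^ 2)
      = (gaussianReal 0 (‖g‖₊ ^ 2)).withDensity D := by
    rw [gaussianReal_map_add_const, zero_add, hcm]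
  calc ∫⁻ ω, G (fun φ => ⟪g, φ⟫ + ε * 𝕎 φ ω) ∂P
      = ∫⁻ ω, (fun z : ℝ × (H → ℝ) => G (Φ (z.1 + a * ‖g‖ ^ 2, z.2)))
          (𝕎 g ω, fun φ => R φ ω) ∂P := by
        refine lintegral_congr fun ω => ?_
        simp only [hΦ, hR]
        congr 1
        ext φ
        rw [← hkg φ, ha]
        field_simp
        ring
    _ = ∫⁻ r, ∫⁻ x, G (Φ (x + a * ‖g‖ ^ 2, r)) ∂(gaussianReal 0 (‖g‖₊ ^ 2))
          ∂(P.map (fun ω φ => R φ ω)) := by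
        have m1 : Measurable (fun z : ℝ × (H → ℝ) => G (Φ (z.1 + a * ‖g‖ ^ 2, z.2))) :=
          hG.comp (mΦ.comp ((measurable_fst.add_const _).prodMk measurable_snd))
        rw [← lintegral_map m1 mpair, hlaw, lintegral_prod_symm _ m1.aemeasurable]
    _ = ∫⁻ r, ∫⁻ x, G (Φ (x, r)) * D x ∂(gaussianReal 0 (‖g‖₊ ^ 2))
          ∂(P.map (fun ω φ => R φ ω)) := by
        refine lintegral_congr fun r => ?_
        have m2 : Measurable (fun x : ℝ => G (Φ (x, r))) :=
          hG.comp (mΦ.comp (measurable_id.prodMk measurable_const))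
        rw [← lintegral_map (f := fun x : ℝ => G (Φ (x, r))) m2 (measurable_add_const _), hshift,
          lintegral_withDensity_eq_lintegral_mul _ mD m2]
        exact lintegral_congr fun x => mul_comm _ _
    _ = ∫⁻ ω, (fun z : ℝ × (H → ℝ) => G (Φ z) * D z.1) (𝕎 g ω, fun φ => R φ ω) ∂P := by
        have m3 : Measurable (fun z : ℝ × (H → ℝ) => G (Φ z) * D z.1) :=
          (hG.comp mΦ).mul (mD.comp measurable_fst)
        rw [← lintegral_map m3 mpair, hlaw, lintegral_prod_symm _ m3.aemeasurable]
    _ = _ := by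
        refine lintegral_congr fun ω => ?_
        simp [hΦ, hR, hD]

/-- White noise has a version that is jointly measurable in the index and the sample. -/
lemma exists_measurable_version [IsProbabilityMeasure P] [TopologicalSpace.SeparableSpace H]
    [MeasurableSpace H] [BorelSpace H] (h : IsWhiteNoise 𝕎 P) (ε : ℝ) :
    ∃ q : H → (H → ℝ) → ℝ, Measurable (Function.uncurry q) ∧
      ∀ g, ∀ᵐ ω ∂P, q g (fun φ => ε * 𝕎 φ ω) = ε * 𝕎 g ω := by
  have hdense (n : ℕ) (g : H) :
      ∃ k, ‖TopologicalSpace.denseSeq H k - g‖ < (1 / 2 : ℝ) ^ n := by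
    obtain ⟨k, hk⟩ := (TopologicalSpace.denseRange_denseSeq H).exists_dist_lt g
      (show (0 : ℝ) < (1 / 2) ^ n by positivity)
    exact ⟨k, by rwa [← dist_eq_norm, dist_comm]⟩
  classical
  -- Taking the first dense point within `2⁻ⁿ` of `g` makes the choice measurable in `g`.
  let idx : ℕ → H → ℕ := fun n g => Nat.find (hdense n g)
  have hidx (n : ℕ) (g : H) : ‖TopologicalSpace.denseSeq H (idx n g) - g‖ < (1 / 2 : ℝ) ^ n :=
    Nat.find_spec (hdense n g)
  have midx (n : ℕ) : Measurable (idx n) := measurable_find _ fun k => by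
    refine measurableSet_lt ?_ measurable_const
    have : Continuous fun g : H => ‖TopologicalSpace.denseSeq H k - g‖ := by fun_prop
    exact this.measurable
  let q' : ℕ → H × (H → ℝ) → ℝ := fun n z => z.2 (TopologicalSpace.denseSeq H (idx n z.1))
  have mq' (n : ℕ) : Measurable (q' n) := by
    have : Measurable (fun z : ℕ × (H → ℝ) => z.2 (TopologicalSpace.denseSeq H z.1)) :=
      measurable_from_prod_countable_right fun k =>
        measurable_pi_apply (TopologicalSpace.denseSeq H k)
    exact this.comp (((midx n).comp measurable_fst).prodMk measurable_snd)
  refine ⟨fun g m => limsup (fun n => q' n (g, m)) atTop, ?_, fun g => ?_⟩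
  · exact Measurable.limsup mq'
  · have mterm (n : ℕ) : AEMeasurable (fun ω => ENNReal.ofReal
        ((𝕎 (TopologicalSpace.denseSeq H (idx n g)) ω - 𝕎 g ω) ^ 2)) P :=
      (((h.measurable _).sub (h.measurable _)).pow_const 2).ennreal_ofReal.aemeasurable
    -- By the isometry the squared `L²` errors are summable, so the approximations converge almost
    -- surely along the full sequence.
    have hsum : ∫⁻ ω, ∑' n, ENNReal.ofReal
        ((𝕎 (TopologicalSpace.denseSeq H (idx n g)) ω - 𝕎 g ω) ^ 2) ∂P ≠ ∞ := by
      rw [lintegral_tsum mterm]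
      simp_rw [h.lintegral_sub_sq]
      refine ne_top_of_le_ne_top (b := ∑' n : ℕ, ENNReal.ofReal ((1 / 2 : ℝ) ^ n)) ?_
        (ENNReal.tsum_le_tsum fun n => ENNReal.ofReal_le_ofReal ?_)
      · rw [← ENNReal.ofReal_tsum_of_nonneg (fun n => by positivity) summable_geometric_two]
        exact ENNReal.ofReal_ne_top
      · have h1 := hidx n g
        have h2 : (1 / 2 : ℝ) ^ n ≤ 1 := pow_le_one₀ (by norm_num) (by norm_num)
        nlinarith [norm_nonneg (TopologicalSpace.denseSeq H (idx n g) - g)]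
    have hae := ae_lt_top' (AEMeasurable.tsum mterm) hsum
    filter_upwards [hae] with ω hω
    have h0 := ENNReal.tendsto_atTop_zero_of_tsum_ne_top hω.ne
    have h1 : Tendsto (fun n => (𝕎 (TopologicalSpace.denseSeq H (idx n g)) ω - 𝕎 g ω) ^ 2)
        atTop (𝓝 0) := by
      have := (ENNReal.tendsto_toReal ENNReal.zero_ne_top).comp h0
      refine (this.congr fun n => ?_)
      simp [ENNReal.toReal_ofReal (sq_nonneg _)]
    have h2 : Tendsto (fun n => 𝕎 (TopologicalSpace.denseSeq H (idx n g)) ω - 𝕎 g ω)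
        atTop (𝓝 0) := by
      have := (Real.continuous_sqrt.tendsto 0).comp h1
      rw [Real.sqrt_zero] at this
      refine tendsto_zero_iff_abs_tendsto_zero _ |>.2 (this.congr fun n => ?_)
      simp [Real.sqrt_sq_eq_abs]
    have h3 : Tendsto (fun n => q' n (g, fun φ => ε * 𝕎 φ ω)) atTop (𝓝 (ε * 𝕎 g ω)) := by
      have := (h2.add_const (𝕎 g ω)).const_mul ε
      simpa [q'] using this
    exact h3.limsup_eq

end IsWhiteNoise

end WhiteNoise

/-! ### Existence of a jointly measurable likelihood -/

section Likelihood

variable {Wbar W₂ Ω : Type*} [NormedAddCommGroup Wbar] [InnerProductSpace ℝ Wbar]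
  [NormedAddCommGroup W₂] [InnerProductSpace ℝ W₂] [MeasurableSpace Ω] {P : Measure Ω}
  {𝕎 : W₂ → Ω → ℝ} {A : Wbar →L[ℝ] W₂} {ε : ℝ}

lemma IsWhiteNoise.measurable_observation (h : IsWhiteNoise 𝕎 P) (A : Wbar →L[ℝ] W₂) (ε : ℝ)
    (f : Wbar) : Measurable (observation A 𝕎 ε f) :=
  measurable_pi_lambda _ fun φ => ((h.measurable φ).const_mul ε).const_add _

omit [MeasurableSpace Ω] in
lemma observation_zero (ω : Ω) : observation A 𝕎 ε 0 ω = fun φ => ε * 𝕎 φ ω := by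
  ext φ
  simp [observation]

/-- A jointly measurable version of the likelihood exists, and it can be chosen positive. -/
lemma exists_isLikelihood [IsProbabilityMeasure P] [TopologicalSpace.SeparableSpace W₂]
    [MeasurableSpace Wbar] [BorelSpace Wbar] (h : IsWhiteNoise 𝕎 P) (A : Wbar →L[ℝ] W₂)
    (hε : 0 < ε) :
    ∃ p, IsLikelihood P A 𝕎 ε p ∧ ∀ f m, p f m ≠ 0 := by
  borelize W₂
  obtain ⟨q, mq, hq⟩ := h.exists_measurable_version ε
  refine ⟨fun f m => ENNReal.ofReal
    (Real.exp ((ε⁻¹) ^ 2 * q (A f) m - (ε⁻¹) ^ 2 * ‖A f‖ ^ 2 / 2)), ⟨?_, fun f => ?_⟩,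
    fun f m => by simp [Real.exp_pos]⟩
  · have m1 : Measurable fun z : Wbar × (W₂ → ℝ) => q (A z.1) z.2 :=
      mq.comp ((A.continuous.measurable.comp measurable_fst).prodMk measurable_snd)
    have m2 : Measurable fun z : Wbar × (W₂ → ℝ) => ‖A z.1‖ := by
      have : Measurable fun f : Wbar => ‖A f‖ := by
        have : Continuous fun f : Wbar => ‖A f‖ := by fun_prop
        exact this.measurable
      exact this.comp measurable_fst
    simp only [Function.uncurry_def]
    fun_prop
  · have mq' : Measurable (q (A f)) := mq.comp measurable_prodMk_left
    have m0 := h.measurable_observation A ε 0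
    have mf := h.measurable_observation A ε f
    ext s hs
    have mG : Measurable (s.indicator (1 : (W₂ → ℝ) → ℝ≥0∞)) := measurable_one.indicator hs
    rw [withDensity_apply _ hs, ← lintegral_indicator hs, ← lintegral_indicator_one hs]
    simp only [observationLaw]
    rw [lintegral_map mG mf, lintegral_map (by fun_prop (disch := exact hs)) m0]
    refine (h.lintegral_shift hε (A f) mG).trans (lintegral_congr_ae ?_)
    filter_upwards [hq (A f)] with ω hω
    rw [observation_zero]
    by_cases hs' : (fun φ => ε * 𝕎 φ ω) ∈ s
    · simp only [hs', Set.indicator_of_mem, Pi.one_apply, one_mul, hω]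
      congr 3
      field_simp
    · simp [hs']

end Likelihood

/-! ### The regularised equation `S x + ε² x = u` -/

section Resolvent

variable {H : Type*} [NormedAddCommGroup H] [InnerProductSpace ℝ H]

/-- Lax–Milgram: `S + ε²` is coercive with constant `ε²`. -/
lemma exists_resolvent [CompleteSpace H] (S : H →L[ℝ] H) (hS : ∀ x, 0 ≤ ⟪S x, x⟫) {ε : ℝ}
    (hε : 0 < ε) (u : H) : ∃ x, S x + ε ^ 2 • x = u := by
  have hunit : IsUnit (S + ε ^ 2 • ContinuousLinearMap.id ℝ H) := by
    refine ContinuousLinearMap.isUnit_of_forall_le_norm_inner_map _ (c := (ε ^ 2).toNNReal)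
      (Real.toNNReal_pos.2 (by positivity)) fun x => ?_
    have e : ⟪(S + ε ^ 2 • ContinuousLinearMap.id ℝ H) x, x⟫ = ⟪S x, x⟫ + ε ^ 2 * ‖x‖ ^ 2 := by
      simp [inner_add_left, inner_smul_left]
    rw [e, Real.norm_eq_abs]
    refine le_trans ?_ (le_abs_self _)
    have := hS x
    rw [Real.coe_toNNReal _ (by positivity)]
    linarith [mul_comm (ε ^ 2) (‖x‖ ^ 2)]
  obtain ⟨x, hx⟩ := (ContinuousLinearMap.isUnit_iff_bijective.1 hunit).2 u
  exact ⟨x, by simpa using hx⟩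

/-- With `σ = √⟪S x, x⟫`, pairing the equation with `x` gives `σ² + (ε ‖x‖)² = ⟪u, x⟫ ≤ K σ`. The
point is that `K` does not depend on `ε`. -/
lemma resolvent_bounds {S : H →L[ℝ] H} (hS : ∀ x, 0 ≤ ⟪S x, x⟫) {ε K : ℝ} (hε : 0 < ε)
    (hK : 0 ≤ K) {u x : H} (hx : S x + ε ^ 2 • x = u) (hu : |⟪u, x⟫| ≤ K * √⟪S x, x⟫) :
    √⟪S x, x⟫ ≤ K ∧ ε * ‖x‖ ≤ K := by
  have h1 : ⟪u, x⟫ = √⟪S x, x⟫ ^ 2 + (ε * ‖x‖) ^ 2 := by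
    rw [← hx, Real.sq_sqrt (hS x)]
    simp [inner_add_left, inner_smul_left]
    ring
  have h2 := (le_abs_self _).trans hu
  rw [h1] at h2
  have hσ := Real.sqrt_nonneg ⟪S x, x⟫
  have h3 : √⟪S x, x⟫ ≤ K := by nlinarith [sq_nonneg (ε * ‖x‖)]
  refine ⟨h3, ?_⟩
  have : 0 ≤ ε * ‖x‖ := by positivity
  nlinarith [sq_nonneg (√⟪S x, x⟫)]

end Resolvent

/-! ### The RKHS norm and the concentration function -/

section CameronMartin

variable {E : Type*} [NormedAddCommGroup E] [InnerProductSpace ℝ E] [MeasurableSpace E]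

lemma abs_le_rkhsNorm_mul {μ : Measure E} {h : E} (hh : h ∈ rkhs μ) (l : StrongDual ℝ E)
    (hl : MemLp l 2 μ) : |l h| ≤ (rkhsNorm μ h).toReal * (eLpNorm l 2 μ).toReal := by
  have hh' : rkhsNorm μ h ≠ ∞ := ne_of_lt hh
  have key (l : StrongDual ℝ E) (hl : eLpNorm l 2 μ ≤ 1) : l h ≤ (rkhsNorm μ h).toReal := by
    have : ENNReal.ofReal (l h) ≤ rkhsNorm μ h := le_iSup₂_of_le l hl le_rfl
    exact (ENNReal.ofReal_le_iff_le_toReal hh').1 this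
  have key2 (l : StrongDual ℝ E) (s : ℝ) (hs : 0 < s) (hl : MemLp l 2 μ)
      (hls : (eLpNorm l 2 μ).toReal ≤ s) : l h ≤ (rkhsNorm μ h).toReal * s := by
    have h1 : eLpNorm ⇑(s⁻¹ • l) 2 μ ≤ 1 := by
      rw [FunLike.coe_smul, eLpNorm_const_smul, ← ENNReal.ofReal_toReal hl.2.ne,
        Real.enorm_eq_ofReal (by positivity),
        ← ENNReal.ofReal_mul (by positivity), ← ENNReal.ofReal_one]
      refine ENNReal.ofReal_le_ofReal ?_
      rw [inv_mul_le_iff₀ hs, mul_one]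
      exact hls
    have h2 := key _ h1
    simp only [smul_apply, smul_eq_mul] at h2
    rwa [inv_mul_le_iff₀ hs, mul_comm] at h2
  have key3 (l : StrongDual ℝ E) (hl : MemLp l 2 μ) :
      l h ≤ (rkhsNorm μ h).toReal * (eLpNorm l 2 μ).toReal := by
    -- Normalising by `s` strictly above the `L²` norm and letting `s` decrease covers functionals
    -- of zero norm.
    have ht : Tendsto (fun s => (rkhsNorm μ h).toReal * s) (𝓝[>] (eLpNorm l 2 μ).toReal)
        (𝓝 ((rkhsNorm μ h).toReal * (eLpNorm l 2 μ).toReal)) :=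
      ((continuous_const.mul continuous_id).tendsto _).mono_left nhdsWithin_le_nhds
    refine ge_of_tendsto ht ?_
    filter_upwards [self_mem_nhdsWithin] with s hs
    exact key2 l s (lt_of_le_of_lt ENNReal.toReal_nonneg hs) hl hs.le
  refine abs_le'.2 ⟨key3 l hl, ?_⟩
  have h4 := key3 (-l) (by rw [FunLike.coe_neg]; exact hl.neg)
  rw [FunLike.coe_neg, eLpNorm_neg] at h4
  simpa using h4

/-- The small-ball term is nonnegative and can be dropped. The infimum need not be attained, so the
bound `a²` is relaxed to `2 a²`, whence the norm bound `2 a`. -/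
lemma exists_mem_rkhs_of_concentrationFunction_le {μ : Measure E} [IsProbabilityMeasure μ]
    {f₀ : E} {δ a : ℝ} (ha : 0 < a) (h : concentrationFunction μ f₀ δ ≤ ((a ^ 2 : ℝ) : EReal)) :
    ∃ g ∈ rkhs μ, ‖g - f₀‖ ≤ δ ∧ (rkhsNorm μ g).toReal ≤ 2 * a := by
  have hlog : ENNReal.log (μ {f | ‖f‖ ≤ δ}) ≤ 0 := by
    rw [← ENNReal.log_one]
    exact ENNReal.log_le_log prob_le_one
  have h1 : ((⨅ (g : E) (_ : g ∈ rkhs μ ∧ ‖g - f₀‖ ≤ δ), rkhsNorm μ g ^ 2 / 2 : ℝ≥0∞) : EReal)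
      ≤ ((a ^ 2 : ℝ) : EReal) := by
    refine le_trans ?_ h
    unfold concentrationFunction
    have := EReal.sub_le_sub (le_refl
      ((⨅ (g : E) (_ : g ∈ rkhs μ ∧ ‖g - f₀‖ ≤ δ), rkhsNorm μ g ^ 2 / 2 : ℝ≥0∞) : EReal)) hlog
    simpa using this
  have h2 : (⨅ (g : E) (_ : g ∈ rkhs μ ∧ ‖g - f₀‖ ≤ δ), rkhsNorm μ g ^ 2 / 2 : ℝ≥0∞)
      < ENNReal.ofReal (2 * a ^ 2) := by
    rw [← EReal.coe_ennreal_lt_coe_ennreal_iff]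
    refine lt_of_le_of_lt h1 ?_
    rw [EReal.coe_ennreal_ofReal, max_eq_left (by positivity), EReal.coe_lt_coe_iff]
    nlinarith [sq_pos_of_pos ha]
  simp only [iInf_lt_iff] at h2
  obtain ⟨g, ⟨hg, hgδ⟩, hlt⟩ := h2
  refine ⟨g, hg, hgδ, ?_⟩
  have hg' : rkhsNorm μ g ≠ ∞ := ne_of_lt hg
  rw [← ENNReal.ofReal_toReal hg', ← ENNReal.ofReal_pow ENNReal.toReal_nonneg,
    show (2 : ℝ≥0∞) = ENNReal.ofReal 2 by simp, ← ENNReal.ofReal_div_of_pos (by norm_num),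
    ENNReal.ofReal_lt_ofReal_iff (by positivity)] at hlt
  nlinarith [ENNReal.toReal_nonneg (a := rkhsNorm μ g)]

end CameronMartin

/-! ### The covariance operator of the image of the prior -/

section ForwardCovariance

variable {Wbar W₂ : Type*} [NormedAddCommGroup Wbar] [InnerProductSpace ℝ Wbar]
  [CompleteSpace Wbar] [MeasurableSpace Wbar] [BorelSpace Wbar]
  [NormedAddCommGroup W₂] [InnerProductSpace ℝ W₂] [CompleteSpace W₂]

/-- The covariance operator of the image of `μ` under `A`. -/
def forwardCovariance (μ : Measure Wbar) (A : Wbar →L[ℝ] W₂) : W₂ →L[ℝ] W₂ :=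
  A ∘L covarianceOperator μ ∘L ContinuousLinearMap.adjoint A

lemma inner_forwardCovariance [TopologicalSpace.SeparableSpace Wbar] (μ : Measure Wbar)
    [IsGaussian μ] (A : Wbar →L[ℝ] W₂) (x y : W₂) :
    ⟪forwardCovariance μ A x, y⟫ = ∫ f, ⟪A f, x⟫ * ⟪A f, y⟫ ∂μ := by
  have : SecondCountableTopology Wbar := UniformSpace.secondCountable_of_separable Wbar
  simp only [forwardCovariance, ContinuousLinearMap.comp_apply]
  rw [← ContinuousLinearMap.adjoint_inner_right,
    covarianceOperator_inner (IsGaussian.memLp_id μ 2 (by norm_num))]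
  simp_rw [ContinuousLinearMap.adjoint_inner_left, real_inner_comm]

/-- The functional `f ↦ ⟪A f, x⟫`. -/
def pairing (A : Wbar →L[ℝ] W₂) (x : W₂) : StrongDual ℝ Wbar := innerSL ℝ x ∘L A

omit [CompleteSpace Wbar] [MeasurableSpace Wbar] [BorelSpace Wbar] [CompleteSpace W₂] in
lemma pairing_apply (A : Wbar →L[ℝ] W₂) (x : W₂) (f : Wbar) : pairing A x f = ⟪A f, x⟫ := by
  simp [pairing, real_inner_comm]

variable [TopologicalSpace.SeparableSpace Wbar] {μ : Measure Wbar} [IsGaussian μ]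

lemma inner_forwardCovariance_self_nonneg (A : Wbar →L[ℝ] W₂) (x : W₂) :
    0 ≤ ⟪forwardCovariance μ A x, x⟫ := by
  rw [inner_forwardCovariance]
  exact integral_nonneg fun f => mul_self_nonneg _

lemma eLpNorm_pairing (A : Wbar →L[ℝ] W₂) (x : W₂) :
    (eLpNorm (pairing A x) 2 μ).toReal = √⟪forwardCovariance μ A x, x⟫ := by
  have h := IsGaussian.memLp_dual μ (pairing A x) 2 (by norm_num)
  rw [h.eLpNorm_eq_integral_rpow_norm (by norm_num) (by norm_num),
    ENNReal.toReal_ofReal (by positivity),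
    inner_forwardCovariance, Real.sqrt_eq_rpow]
  simp [pairing_apply, sq]

lemma abs_inner_le_of_mem_rkhs (A : Wbar →L[ℝ] W₂) {h : Wbar} (hh : h ∈ rkhs μ) (x : W₂) :
    |⟪A h, x⟫| ≤ (rkhsNorm μ h).toReal * √⟪forwardCovariance μ A x, x⟫ := by
  rw [← pairing_apply, ← eLpNorm_pairing]
  exact abs_le_rkhsNorm_mul hh _ (IsGaussian.memLp_dual μ _ 2 (by norm_num))

end ForwardCovariance

/-! ### Joint Gaussianity of parameter and noise -/

section JointModel

variable {Wbar W₂ Ω : Type*} [NormedAddCommGroup Wbar] [InnerProductSpace ℝ Wbar]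
  [CompleteSpace Wbar] [TopologicalSpace.SeparableSpace Wbar] [MeasurableSpace Wbar]
  [BorelSpace Wbar] [NormedAddCommGroup W₂] [InnerProductSpace ℝ W₂] [CompleteSpace W₂]
  [MeasurableSpace Ω] {P : Measure Ω} [IsProbabilityMeasure P] {𝕎 : W₂ → Ω → ℝ}
  {prior : Measure Wbar} [IsGaussian prior]

/-- A linear functional of the signal plus noise, as a random variable on the joint space of
parameter and noise. -/
def signalPlusNoise (A : Wbar →L[ℝ] W₂) (𝕎 : W₂ → Ω → ℝ) (ε : ℝ) (a : W₂ × W₂) (z : Wbar × Ω) : ℝ :=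
  pairing A a.1 z.1 + ε * 𝕎 a.2 z.2

omit [CompleteSpace Wbar] [TopologicalSpace.SeparableSpace Wbar] [MeasurableSpace Wbar]
  [BorelSpace Wbar] [CompleteSpace W₂] [MeasurableSpace Ω] in
lemma observation_eq_signalPlusNoise (A : Wbar →L[ℝ] W₂) (𝕎 : W₂ → Ω → ℝ) (ε : ℝ) (φ : W₂)
    (z : Wbar × Ω) : observation A 𝕎 ε z.1 z.2 φ = signalPlusNoise A 𝕎 ε (φ, φ) z := by
  simp [observation, signalPlusNoise, pairing_apply]

omit [CompleteSpace Wbar] [TopologicalSpace.SeparableSpace Wbar] [CompleteSpace W₂]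
  [IsProbabilityMeasure P] in
lemma measurable_signalPlusNoise (h : IsWhiteNoise 𝕎 P) (A : Wbar →L[ℝ] W₂) (ε : ℝ) (a : W₂ × W₂) :
    Measurable (signalPlusNoise A 𝕎 ε a) :=
  ((pairing A a.1).continuous.measurable.comp measurable_fst).add
    (((h.measurable a.2).comp measurable_snd).const_mul ε)

-- Indexing by pairs puts the observation, index `(φ, φ)`, and the residual `L f + M v`, index `(v -
-- u, v)`, into one Gaussian family. Finite marginals are linear images of two independent Gaussian
-- vectors.
omit [CompleteSpace Wbar] [CompleteSpace W₂] in
lemma isGaussianProcess_signalPlusNoise (h : IsWhiteNoise 𝕎 P) (A : Wbar →L[ℝ] W₂) (ε : ℝ) :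
    IsGaussianProcess (signalPlusNoise A 𝕎 ε) (prior.prod P) where
  hasGaussianLaw I := by
    classical
    have : SecondCountableTopology Wbar := UniformSpace.secondCountable_of_separable Wbar
    let J : Finset W₂ := I.image Prod.snd
    let LX : Wbar →L[ℝ] (I → ℝ) := ContinuousLinearMap.pi fun i => pairing A i.1.1
    have hX : HasGaussianLaw (fun z : Wbar × Ω => LX z.1) (prior.prod P) := by
      constructor
      change IsGaussian ((prior.prod P).map (LX ∘ Prod.fst))
      rw [← Measure.map_map LX.continuous.measurable measurable_fst, measurePreserving_fst.map_eq]
      infer_instance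
    have mY : Measurable (fun ω => J.restrict (𝕎 · ω)) :=
      measurable_pi_lambda _ fun j => h.measurable _
    have hY : HasGaussianLaw (fun z : Wbar × Ω => J.restrict (𝕎 · z.2)) (prior.prod P) := by
      constructor
      change IsGaussian ((prior.prod P).map ((fun ω => J.restrict (𝕎 · ω)) ∘ Prod.snd))
      rw [← Measure.map_map mY measurable_snd, measurePreserving_snd.map_eq]
      exact ((IsWhiteNoise.isGaussianProcess h).hasGaussianLaw J).isGaussian_map
    have hind : IndepFun (fun z : Wbar × Ω => LX z.1) (fun z : Wbar × Ω => J.restrict (𝕎 · z.2))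
        (prior.prod P) := indepFun_prod LX.continuous.measurable mY
    have hXY := hind.hasGaussianLaw hX hY
    let T : (I → ℝ) × (J → ℝ) →L[ℝ] (I → ℝ) := ContinuousLinearMap.fst ℝ _ _ +
      ε • (ContinuousLinearMap.pi fun i : I => ContinuousLinearMap.proj (R := ℝ)
        (φ := fun _ : J => ℝ) ⟨i.1.2, Finset.mem_image_of_mem _ i.2⟩) ∘L
          ContinuousLinearMap.snd ℝ (I → ℝ) (J → ℝ)
    refine (hXY.map T).congr (ae_of_all _ fun z => ?_)
    ext i
    simp [T, LX, signalPlusNoise]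

omit [CompleteSpace W₂] in
lemma integral_pairing (hprior : ∫ f, f ∂prior = 0) (A : Wbar →L[ℝ] W₂) (x : W₂) :
    ∫ f, pairing A x f ∂prior = 0 := by
  have : SecondCountableTopology Wbar := UniformSpace.secondCountable_of_separable Wbar
  rw [IsGaussian.integral_dual, hprior, map_zero]

omit [CompleteSpace W₂] in
lemma integral_signalPlusNoise (h : IsWhiteNoise 𝕎 P) (hprior : ∫ f, f ∂prior = 0)
    (A : Wbar →L[ℝ] W₂) (ε : ℝ) (a : W₂ × W₂) :
    ∫ z, signalPlusNoise A 𝕎 ε a z ∂(prior.prod P) = 0 := by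
  have i1 : Integrable (fun z : Wbar × Ω => pairing A a.1 z.1) (prior.prod P) :=
    (IsGaussian.integrable_dual prior _).comp_fst P
  have i2 : Integrable (fun z : Wbar × Ω => ε * 𝕎 a.2 z.2) (prior.prod P) :=
    (((h.memLp_two a.2).integrable (by norm_num)).comp_snd prior).const_mul ε
  simp only [signalPlusNoise]
  rw [integral_add i1 i2, integral_const_mul, integral_fun_fst, integral_fun_snd,
    integral_pairing hprior, h.centred]
  simp

lemma covariance_signalPlusNoise (h : IsWhiteNoise 𝕎 P) (hprior : ∫ f, f ∂prior = 0)
    (A : Wbar →L[ℝ] W₂) (ε : ℝ) (a b : W₂ × W₂) :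
    cov[signalPlusNoise A 𝕎 ε a, signalPlusNoise A 𝕎 ε b; prior.prod P] =
      ⟪forwardCovariance prior A a.1, b.1⟫ + ε ^ 2 * ⟪a.2, b.2⟫ := by
  have hX (x : W₂) : MemLp (fun z : Wbar × Ω => pairing A x z.1) 2 (prior.prod P) :=
    (IsGaussian.memLp_dual prior _ 2 (by norm_num)).comp_fst P
  have hY (x : W₂) : MemLp (fun z : Wbar × Ω => 𝕎 x z.2) 2 (prior.prod P) :=
    (h.memLp_two x).comp_snd prior
  have hY' (x : W₂) : MemLp (fun z : Wbar × Ω => ε * 𝕎 x z.2) 2 (prior.prod P) :=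
    (hY x).const_mul ε
  have cXX (x y : W₂) : cov[fun z : Wbar × Ω => pairing A x z.1, fun z => pairing A y z.1;
      prior.prod P] = ⟪forwardCovariance prior A x, y⟫ := by
    rw [covariance_eq_sub (hX x) (hX y), integral_fun_fst, integral_pairing hprior,
      smul_zero, zero_mul, sub_zero, inner_forwardCovariance]
    simp only [Pi.mul_apply]
    rw [integral_fun_fst (fun f => pairing A x f * pairing A y f)]
    simp [pairing_apply]
  have cYY (x y : W₂) : cov[fun z : Wbar × Ω => 𝕎 x z.2, fun z => 𝕎 y z.2;
      prior.prod P] = ⟪x, y⟫ := by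
    rw [covariance_eq_sub (hY x) (hY y), integral_fun_snd, h.centred,
      smul_zero, zero_mul, sub_zero]
    simp only [Pi.mul_apply]
    rw [integral_fun_snd (fun ω => 𝕎 x ω * 𝕎 y ω), h.covariance]
    simp
  have cXY (x y : W₂) : cov[fun z : Wbar × Ω => pairing A x z.1, fun z => 𝕎 y z.2;
      prior.prod P] = 0 :=
    covariance_fst_snd_prod (IsGaussian.memLp_dual prior _ 2 (by norm_num)) (h.memLp_two y)
  have e (c : W₂ × W₂) : signalPlusNoise A 𝕎 ε c = (fun z : Wbar × Ω => pairing A c.1 z.1)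
      + fun z => ε * 𝕎 c.2 z.2 := rfl
  rw [e a, e b, covariance_add_left (hX _) (hY' _) ((hX _).add (hY' _)),
    covariance_add_right (hX _) (hX _) (hY' _), covariance_add_right (hY' _) (hX _) (hY' _),
    covariance_const_mul_right, covariance_const_mul_right, covariance_const_mul_left,
    covariance_const_mul_left, cXX, cYY, cXY, covariance_comm, cXY]
  ring

omit [CompleteSpace Wbar] [TopologicalSpace.SeparableSpace Wbar] [CompleteSpace W₂]
  [IsProbabilityMeasure P] in
lemma measurable_uncurry_observation (h : IsWhiteNoise 𝕎 P) (A : Wbar →L[ℝ] W₂) (ε : ℝ) :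
    Measurable (fun z : Wbar × Ω => observation A 𝕎 ε z.1 z.2) := by
  refine measurable_pi_lambda _ fun φ => ?_
  simp only [observation_eq_signalPlusNoise]
  exact measurable_signalPlusNoise h A ε (φ, φ)

/-- Condition `ha` says that the covariance with each coordinate of the observation vanishes. -/
lemma indepFun_signalPlusNoise_observation (h : IsWhiteNoise 𝕎 P) (hprior : ∫ f, f ∂prior = 0)
    (A : Wbar →L[ℝ] W₂) (ε : ℝ) (a : W₂ × W₂)
    (ha : ∀ φ, ⟪forwardCovariance prior A a.1, φ⟫ + ε ^ 2 * ⟪a.2, φ⟫ = 0) :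
    IndepFun (signalPlusNoise A 𝕎 ε a) (fun z : Wbar × Ω => observation A 𝕎 ε z.1 z.2)
      (prior.prod P) := by
  have hg : IsGaussianProcess (Sum.elim (fun _ : Unit => signalPlusNoise A 𝕎 ε a)
      (fun φ => signalPlusNoise A 𝕎 ε (φ, φ))) (prior.prod P) := by
    have := (isGaussianProcess_signalPlusNoise (prior := prior) h A ε).comp_right
      (Sum.elim (fun _ : Unit => a) (fun φ => (φ, φ)))
    rwa [Sum.comp_elim] at this
  have hind := hg.indepFun_of_covariance_eq_zero
    (fun _ => (measurable_signalPlusNoise h A ε a).aemeasurable)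
    (fun φ => (measurable_signalPlusNoise h A ε (φ, φ)).aemeasurable)
    (fun _ φ => by rw [covariance_signalPlusNoise h hprior]; exact ha φ)
  have e : (fun z : Wbar × Ω => observation A 𝕎 ε z.1 z.2)
      = fun z φ => signalPlusNoise A 𝕎 ε (φ, φ) z := by
    ext z φ
    exact observation_eq_signalPlusNoise A 𝕎 ε φ z
  rw [e]
  exact hind.comp (measurable_pi_apply ()) measurable_id

lemma map_signalPlusNoise (h : IsWhiteNoise 𝕎 P) (hprior : ∫ f, f ∂prior = 0)
    (A : Wbar →L[ℝ] W₂) (ε : ℝ) (a : W₂ × W₂) :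
    (prior.prod P).map (signalPlusNoise A 𝕎 ε a) = gaussianReal 0
      (⟪forwardCovariance prior A a.1, a.1⟫ + ε ^ 2 * ‖a.2‖ ^ 2).toNNReal := by
  rw [((isGaussianProcess_signalPlusNoise h A ε).hasGaussianLaw_eval a).map_eq_gaussianReal,
    integral_signalPlusNoise h hprior,
    ← covariance_self (measurable_signalPlusNoise h A ε a).aemeasurable,
    covariance_signalPlusNoise h hprior, real_inner_self_eq_norm_sq]

end JointModel

/-! ### Bayes' formula as a conditional law -/

section Bayes

variable {Wbar W₂ Ω : Type*} [NormedAddCommGroup Wbar] [InnerProductSpace ℝ Wbar]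
  [MeasurableSpace Wbar] [BorelSpace Wbar] [NormedAddCommGroup W₂] [InnerProductSpace ℝ W₂]
  [MeasurableSpace Ω] {P : Measure Ω} [IsProbabilityMeasure P] {𝕎 : W₂ → Ω → ℝ}
  {prior : Measure Wbar} [IsProbabilityMeasure prior] {A : Wbar →L[ℝ] W₂} {ε : ℝ}
  {p : Wbar → (W₂ → ℝ) → ℝ≥0∞}

omit [MeasurableSpace Wbar] [BorelSpace Wbar] in
lemma isProbabilityMeasure_observationLaw (h : IsWhiteNoise 𝕎 P) (A : Wbar →L[ℝ] W₂) (ε : ℝ)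
    (f : Wbar) : IsProbabilityMeasure (observationLaw P A 𝕎 ε f) :=
  Measure.isProbabilityMeasure_map (h.measurable_observation A ε f).aemeasurable

/-- The joint law of parameter and observation has density `p` with respect to the product of the
prior and the pure-noise law. Every almost sure property of the posterior below is read off from
this by testing. -/
lemma lintegral_joint (h : IsWhiteNoise 𝕎 P) (hp : IsLikelihood P A 𝕎 ε p)
    {G : Wbar × (W₂ → ℝ) → ℝ≥0∞} (hG : Measurable G) :
    ∫⁻ z, G (z.1, observation A 𝕎 ε z.1 z.2) ∂(prior.prod P) =
      ∫⁻ m, ∫⁻ f, p f m * G (f, m) ∂prior ∂(observationLaw P A 𝕎 ε 0) := by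
  have := isProbabilityMeasure_observationLaw h A ε 0
  have mp : Measurable (fun z : Wbar × (W₂ → ℝ) => p z.1 z.2) := hp.measurable
  have mobs := measurable_uncurry_observation h A ε
  have mGobs : Measurable fun z : Wbar × Ω => G (z.1, observation A 𝕎 ε z.1 z.2) :=
    hG.comp (measurable_fst.prodMk mobs)
  rw [lintegral_prod _ mGobs.aemeasurable,
    ← lintegral_lintegral_swap (f := fun f m => p f m * G (f, m)) (mp.mul hG).aemeasurable]
  refine lintegral_congr fun f => ?_
  have mGf : Measurable fun m => G (f, m) := hG.comp measurable_prodMk_left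
  rw [← lintegral_map (f := fun m => G (f, m)) mGf (h.measurable_observation A ε f)]
  change ∫⁻ m, G (f, m) ∂(observationLaw P A 𝕎 ε f) = _
  have mpf : Measurable (p f) := mp.comp measurable_prodMk_left
  rw [hp.density f, lintegral_withDensity_eq_lintegral_mul _ mpf mGf]
  rfl

omit [BorelSpace Wbar] [IsProbabilityMeasure P] in
lemma measurable_evidence (hp : IsLikelihood P A 𝕎 ε p) :
    Measurable fun m => ∫⁻ f, p f m ∂prior :=
  Measurable.lintegral_prod_left' hp.measurable

/-- An arbitrary version agrees almost everywhere, for each `f`, with the strictly positive one;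
Fubini exchanges the order of the null sets. -/
lemma ae_evidence_ne_zero [TopologicalSpace.SeparableSpace W₂] (h : IsWhiteNoise 𝕎 P)
    (hε : 0 < ε) (hp : IsLikelihood P A 𝕎 ε p) :
    ∀ᵐ m ∂(observationLaw P A 𝕎 ε 0), ∫⁻ f, p f m ∂prior ≠ 0 := by
  have := isProbabilityMeasure_observationLaw h A ε 0
  obtain ⟨q, hq, hq0⟩ := exists_isLikelihood h A hε
  have hpq (f : Wbar) : ∀ᵐ m ∂(observationLaw P A 𝕎 ε 0), p f m ≠ 0 := by
    have e := (withDensity_eq_iff_of_sigmaFinite (μ := observationLaw P A 𝕎 ε 0)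
      (hp.measurable.comp measurable_prodMk_left).aemeasurable
      (hq.measurable.comp measurable_prodMk_left).aemeasurable).1
      ((hp.density f).symm.trans (hq.density f))
    filter_upwards [e] with m hm
    have hm' : p f m = q f m := hm
    rw [hm']
    exact hq0 f m
  have hms : MeasurableSet {z : Wbar × (W₂ → ℝ) | p z.1 z.2 ≠ 0} :=
    (hp.measurable (measurableSet_singleton 0)).compl
  have hswap := (Measure.ae_ae_comm (μ := prior) (ν := observationLaw P A 𝕎 ε 0) hms).1
    (ae_of_all _ hpq)
  filter_upwards [hswap] with m hm h0
  have mpm : Measurable fun f => p f m := hp.measurable.comp measurable_prodMk_right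
  rw [lintegral_eq_zero_iff mpm] at h0
  have : ∀ᵐ f ∂prior, False := by
    filter_upwards [hm, h0] with f h1 h2 using h1 h2
  rw [eventually_false_iff_eq_bot, ae_eq_bot] at this
  exact IsProbabilityMeasure.ne_zero prior this

lemma ae_evidence_ne_top (h : IsWhiteNoise 𝕎 P) (hp : IsLikelihood P A 𝕎 ε p) :
    ∀ᵐ m ∂(observationLaw P A 𝕎 ε 0), ∫⁻ f, p f m ∂prior ≠ ∞ := by
  have e := lintegral_joint (prior := prior) h hp (G := fun _ => 1) measurable_const
  simp only [lintegral_one, measure_univ, mul_one] at e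
  filter_upwards [ae_lt_top (measurable_evidence hp) (e ▸ ENNReal.one_ne_top)] with m hm
  exact hm.ne

omit [NormedAddCommGroup Wbar] [InnerProductSpace ℝ Wbar] [BorelSpace Wbar]
  [NormedAddCommGroup W₂] [InnerProductSpace ℝ W₂] [IsProbabilityMeasure prior] in
lemma isProbabilityMeasure_bayesPosterior {m : W₂ → ℝ} (h0 : ∫⁻ f, p f m ∂prior ≠ 0)
    (h1 : ∫⁻ f, p f m ∂prior ≠ ∞) : IsProbabilityMeasure (bayesPosterior prior p m) := by
  constructor
  simp only [bayesPosterior, Measure.smul_apply, smul_eq_mul]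
  rw [withDensity_apply _ MeasurableSet.univ, setLIntegral_univ]
  exact ENNReal.inv_mul_cancel h0 h1

lemma ae_integrable_bayesPosterior [SecondCountableTopology Wbar] (h : IsWhiteNoise 𝕎 P)
    (hε : 0 < ε) [TopologicalSpace.SeparableSpace W₂]
    (hp : IsLikelihood P A 𝕎 ε p) (hint : Integrable (fun f : Wbar => f) prior) :
    ∀ᵐ m ∂(observationLaw P A 𝕎 ε 0), Integrable (fun f => f) (bayesPosterior prior p m) := by
  have mn : Measurable fun z : Wbar × (W₂ → ℝ) => ‖z.1‖ₑ := measurable_fst.enorm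
  have e := lintegral_joint (prior := prior) h hp (G := fun z => ‖z.1‖ₑ) mn
  have mp : Measurable (fun z : Wbar × (W₂ → ℝ) => p z.1 z.2) := hp.measurable
  have hfin : ∫⁻ z : Wbar × Ω, ‖z.1‖ₑ ∂(prior.prod P) ≠ ∞ := (hint.comp_fst P).2.ne
  simp only at e
  rw [e] at hfin
  filter_upwards [ae_lt_top (Measurable.lintegral_prod_left' (mp.mul mn)) hfin,
    ae_evidence_ne_zero (prior := prior) h hε hp] with m hm h0
  have mpm : Measurable fun f => p f m := mp.comp measurable_prodMk_right
  refine Integrable.smul_measure ⟨measurable_id.aestronglyMeasurable, ?_⟩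
    (ENNReal.inv_ne_top.2 h0)
  rw [HasFiniteIntegral, lintegral_withDensity_eq_lintegral_mul _ mpm measurable_id.enorm]
  exact hm

/-- If under the joint law of parameter and observation the variable `T f m` is independent of the
observation, then almost surely its law under the posterior is its unconditional law. -/
lemma ae_map_bayesPosterior_eq [TopologicalSpace.SeparableSpace W₂] (h : IsWhiteNoise 𝕎 P)
    (hε : 0 < ε) (hp : IsLikelihood P A 𝕎 ε p) {T : Wbar × (W₂ → ℝ) → ℝ} (hT : Measurable T)
    (hind : IndepFun (fun z : Wbar × Ω => T (z.1, observation A 𝕎 ε z.1 z.2))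
      (fun z : Wbar × Ω => observation A 𝕎 ε z.1 z.2) (prior.prod P)) :
    ∀ᵐ m ∂(observationLaw P A 𝕎 ε 0), (bayesPosterior prior p m).map (fun f => T (f, m)) =
      (prior.prod P).map (fun z : Wbar × Ω => T (z.1, observation A 𝕎 ε z.1 z.2)) := by
  have := isProbabilityMeasure_observationLaw h A ε 0
  set ν := (prior.prod P).map (fun z : Wbar × Ω => T (z.1, observation A 𝕎 ε z.1 z.2)) with hν
  have mobs := measurable_uncurry_observation h A ε
  have mTobs : Measurable (fun z : Wbar × Ω => T (z.1, observation A 𝕎 ε z.1 z.2)) :=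
    hT.comp (measurable_fst.prodMk mobs)
  have : IsProbabilityMeasure ν := Measure.isProbabilityMeasure_map mTobs.aemeasurable
  have mp : Measurable (fun z : Wbar × (W₂ → ℝ) => p z.1 z.2) := hp.measurable
  have key (B : Set ℝ) (hB : MeasurableSet B) : ∀ᵐ m ∂(observationLaw P A 𝕎 ε 0),
      ∫⁻ f, p f m * B.indicator 1 (T (f, m)) ∂prior = ν B * ∫⁻ f, p f m ∂prior := by
    have mB : Measurable (fun z => B.indicator (1 : ℝ → ℝ≥0∞) (T z)) :=
      (measurable_one.indicator hB).comp hT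
    have mI : Measurable fun m => ∫⁻ f, p f m * B.indicator 1 (T (f, m)) ∂prior :=
      Measurable.lintegral_prod_left' (mp.mul mB)
    -- Integrated over any event `D` for the observation, the identity is the product rule for `T ∈
    -- B` and `M ∈ D`.
    refine ae_eq_of_forall_setLIntegral_eq_of_sigmaFinite mI
      ((measurable_evidence hp).const_mul _) fun D hD _ => ?_
    have mD : Measurable (fun z : Wbar × (W₂ → ℝ) => D.indicator (1 : (W₂ → ℝ) → ℝ≥0∞) z.2) :=
      (measurable_one.indicator hD).comp measurable_snd
    have e1 := lintegral_joint (prior := prior) h hp (mB.mul mD)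
    have e2 := lintegral_joint (prior := prior) h hp mD
    have l1 : ∫⁻ m in D, ∫⁻ f, p f m * B.indicator 1 (T (f, m)) ∂prior ∂observationLaw P A 𝕎 ε 0
        = (prior.prod P) {z | T (z.1, observation A 𝕎 ε z.1 z.2) ∈ B ∧
            observation A 𝕎 ε z.1 z.2 ∈ D} := by
      rw [← lintegral_indicator_one (by exact (mTobs hB).inter (mobs hD)), ← lintegral_indicator hD]
      refine Eq.trans (lintegral_congr fun m => ?_) (e1.symm.trans (lintegral_congr fun z => ?_))
      · by_cases hm : m ∈ D <;> simp [hm]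
      · by_cases h1 : T (z.1, observation A 𝕎 ε z.1 z.2) ∈ B <;>
          by_cases h2 : observation A 𝕎 ε z.1 z.2 ∈ D <;> simp [h1, h2]
    have l2 : ∫⁻ m in D, ∫⁻ f, p f m ∂prior ∂observationLaw P A 𝕎 ε 0
        = (prior.prod P) {z | observation A 𝕎 ε z.1 z.2 ∈ D} := by
      rw [← lintegral_indicator_one (by exact mobs hD), ← lintegral_indicator hD]
      refine Eq.trans (lintegral_congr fun m => ?_) (e2.symm.trans (lintegral_congr fun z => ?_))
      · by_cases hm : m ∈ D <;> simp [hm]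
      · by_cases h2 : observation A 𝕎 ε z.1 z.2 ∈ D <;> simp [h2]
    rw [l1, lintegral_const_mul _ (measurable_evidence hp), l2, hν, Measure.map_apply mTobs hB]
    exact (indepFun_iff_measure_inter_preimage_eq_mul.1 hind) B D hB hD
  -- The null set in `key` depends on `B`; countably many rational intervals suffice to determine
  -- the law.
  have hall : ∀ᵐ m ∂(observationLaw P A 𝕎 ε 0), ∀ a b : ℚ,
      ∫⁻ f, p f m * (Set.Ioo (a : ℝ) b).indicator 1 (T (f, m)) ∂prior
        = ν (Set.Ioo (a : ℝ) b) * ∫⁻ f, p f m ∂prior :=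
    ae_all_iff.2 fun a => ae_all_iff.2 fun b => key _ measurableSet_Ioo
  filter_upwards [hall, ae_evidence_ne_zero (prior := prior) h hε hp,
    ae_evidence_ne_top (prior := prior) h hp] with m hm h0 h1
  have := isProbabilityMeasure_bayesPosterior h0 h1
  have mTm : Measurable fun f => T (f, m) := hT.comp measurable_prodMk_right
  have mpm : Measurable fun f => p f m := mp.comp measurable_prodMk_right
  have : IsProbabilityMeasure ((bayesPosterior prior p m).map (fun f => T (f, m))) :=
    Measure.isProbabilityMeasure_map mTm.aemeasurable
  refine Real.measure_ext_Ioo_rat fun a b => ?_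
  rw [Measure.map_apply mTm measurableSet_Ioo]
  simp only [bayesPosterior, Measure.smul_apply, smul_eq_mul]
  rw [withDensity_apply _ (mTm measurableSet_Ioo), ← lintegral_indicator (mTm measurableSet_Ioo)]
  have e : ∫⁻ f, ((fun f => T (f, m)) ⁻¹' Set.Ioo (a : ℝ) b).indicator (fun f => p f m) f ∂prior
      = ν (Set.Ioo (a : ℝ) b) * ∫⁻ f, p f m ∂prior := by
    rw [← hm a b]
    refine lintegral_congr fun f => ?_
    by_cases hf : T (f, m) ∈ Set.Ioo (a : ℝ) b
    · rw [Set.indicator_of_mem (by exact hf), Set.indicator_of_mem hf, Pi.one_apply, mul_one]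
    · rw [Set.indicator_of_notMem (by exact hf), Set.indicator_of_notMem hf, mul_zero]
  rw [e, mul_comm (ν _), ← mul_assoc, ENNReal.inv_mul_cancel h0 h1, one_mul]

end Bayes

/-! ### Weak convergence of Gaussian laws -/

section WeakConvergence

/-- The centred Gaussian law with a given variance. -/
def centredGaussian (v : ℝ≥0) : ProbabilityMeasure ℝ := ⟨gaussianReal 0 v, inferInstance⟩

lemma continuous_centredGaussian : Continuous centredGaussian := by
  refine SeqContinuous.continuous fun w v hw => ?_
  rw [ProbabilityMeasure.tendsto_iff_tendsto_charFun]
  intro t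
  simp only [centredGaussian, Function.comp_apply, ProbabilityMeasure.coe_mk, charFun_gaussianReal]
  have hc : Continuous fun y : ℝ≥0 =>
      Complex.exp (t * (0 : ℝ) * Complex.I - ((y : ℝ) : ℂ) * t ^ 2 / 2) := by fun_prop
  exact (hc.tendsto v).comp hw

/-- The random laws are almost surely nonrandom, so the exceptional event is eventually null for any
admissible metric. -/
lemma tendstoWeaklyInProbability_of_ae_eq {Ω : Type*} [MeasurableSpace Ω] {P : Measure Ω}
    {μ : ℝ → Ω → Measure ℝ} {l : Filter ℝ} {ν : ProbabilityMeasure ℝ}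
    {ρ : ℝ → ProbabilityMeasure ℝ} (hρ : Tendsto ρ l (𝓝 ν))
    (h : ∀ᶠ ε in l, ∀ᵐ ω ∂P, μ ε ω = ρ ε) : TendstoWeaklyInProbability P μ l ν := by
  intro d hd r hr
  have hball : ∀ᶠ ε in l, d.dist (ρ ε) ν < r := by
    have hmem : {x | d.dist x ν < r} ∈ 𝓝 ν := by
      have h1 : {x | d.dist x ν < r} ∈
          @nhds _ d.toPseudoMetricSpace.toUniformSpace.toTopologicalSpace ν :=
        @Metric.ball_mem_nhds _ d.toPseudoMetricSpace ν r hr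
      rwa [hd] at h1
    exact hρ hmem
  refine tendsto_const_nhds.congr' ?_
  filter_upwards [h, hball] with ε h1 h2
  refine (measure_mono_null (fun ω hω heq => ?_) (ae_iff.1 h1)).symm
  have hprob : IsProbabilityMeasure (μ ε ω) := heq ▸ (ρ ε).2
  have e : (⟨μ ε ω, hprob⟩ : ProbabilityMeasure ℝ) = ρ ε := Subtype.ext heq
  have h3 := hω hprob
  rw [e] at h3
  exact absurd h3 (not_le.2 h2)

end WeakConvergence

/-! ### Exact posterior of the functional -/

section Posterior

variable {Wbar W₂ Ω : Type*} [NormedAddCommGroup Wbar] [InnerProductSpace ℝ Wbar]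
  [CompleteSpace Wbar] [TopologicalSpace.SeparableSpace Wbar] [MeasurableSpace Wbar]
  [BorelSpace Wbar] [NormedAddCommGroup W₂] [InnerProductSpace ℝ W₂] [CompleteSpace W₂]
  [TopologicalSpace.SeparableSpace W₂]
  [MeasurableSpace Ω] {P : Measure Ω} [IsProbabilityMeasure P] {𝕎 : W₂ → Ω → ℝ}
  {prior : Measure Wbar} [IsGaussian prior] {A : Wbar →L[ℝ] W₂} {ε : ℝ}
  {p : Wbar → (W₂ → ℝ) → ℝ≥0∞}

-- This passes from the Bayesian model to a fixed truth `f₀`: the law of the data under `f₀` has a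
-- density with respect to the pure-noise law.
omit [CompleteSpace Wbar] [TopologicalSpace.SeparableSpace Wbar] [CompleteSpace W₂]
  [TopologicalSpace.SeparableSpace W₂] [BorelSpace Wbar] [IsProbabilityMeasure P] in
lemma ae_observation_of_ae_zero (h : IsWhiteNoise 𝕎 P) (hp : IsLikelihood P A 𝕎 ε p) (f₀ : Wbar)
    {q : (W₂ → ℝ) → Prop} (hq : ∀ᵐ m ∂(observationLaw P A 𝕎 ε 0), q m) :
    ∀ᵐ ω ∂P, q (observation A 𝕎 ε f₀ ω) := by
  have hac : observationLaw P A 𝕎 ε f₀ ≪ observationLaw P A 𝕎 ε 0 := by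
    rw [hp.density f₀]
    exact withDensity_absolutelyContinuous _ _
  exact ae_of_ae_map (h.measurable_observation A ε f₀).aemeasurable (hac.ae_le hq)

omit [CompleteSpace W₂] in
lemma ae_isProbabilityMeasure_and_integrable (h : IsWhiteNoise 𝕎 P) (hε : 0 < ε)
    (hp : IsLikelihood P A 𝕎 ε p) (f₀ : Wbar) : ∀ᵐ ω ∂P,
      IsProbabilityMeasure (bayesPosterior prior p (observation A 𝕎 ε f₀ ω)) ∧
      Integrable (fun f => f) (bayesPosterior prior p (observation A 𝕎 ε f₀ ω)) := by
  have : SecondCountableTopology Wbar := UniformSpace.secondCountable_of_separable Wbar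
  refine ae_observation_of_ae_zero h hp f₀
    (q := fun m => IsProbabilityMeasure (bayesPosterior prior p m) ∧
      Integrable (fun f => f) (bayesPosterior prior p m)) ?_
  filter_upwards [ae_evidence_ne_zero (prior := prior) h hε hp,
    ae_evidence_ne_top (prior := prior) h hp,
    ae_integrable_bayesPosterior (prior := prior) h hε hp IsGaussian.integrable_id]
    with m h0 h1 h2 using ⟨isProbabilityMeasure_bayesPosterior h0 h1, h2⟩

/-- The posterior of a functional `f ↦ -⟪A f, u⟫`: its mean and its rescaled law, in terms of a
solution `x` of the resolvent equation. -/
lemma ae_posterior_functional (h : IsWhiteNoise 𝕎 P) (hprior : ∫ f, f ∂prior = 0) (hε : 0 < ε)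
    (hp : IsLikelihood P A 𝕎 ε p) (f₀ : Wbar) {u x : W₂}
    (hx : forwardCovariance prior A x + ε ^ 2 • x = u) {L : StrongDual ℝ Wbar}
    (hL : ∀ f, L f = -⟪A f, u⟫) : ∀ᵐ ω ∂P,
      L (posteriorMean prior p (observation A 𝕎 ε f₀ ω)) =
        -observation A 𝕎 ε f₀ ω (u - ε ^ 2 • x) ∧
      (bayesPosterior prior p (observation A 𝕎 ε f₀ ω)).map (fun f => ε⁻¹ * (L f -
        L (posteriorMean prior p (observation A 𝕎 ε f₀ ω)))) = gaussianReal 0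
          (ε ^ 2 * ⟪forwardCovariance prior A x, x⟫ + ‖u - ε ^ 2 • x‖ ^ 2).toNNReal := by
  set v := u - ε ^ 2 • x with hv
  have hvS : forwardCovariance prior A x = v := by rw [hv, ← hx]; simp
  have hvu : v - u = -(ε ^ 2 • x) := by rw [hv]; abel
  set s : ℝ := ⟪forwardCovariance prior A (v - u), v - u⟫ + ε ^ 2 * ‖v‖ ^ 2 with hs
  have hs' : s = ε ^ 2 * (ε ^ 2 * ⟪forwardCovariance prior A x, x⟫ + ‖v‖ ^ 2) := by
    rw [hs, hvu]
    simp only [map_neg, map_smul, inner_neg_neg, inner_smul_left, inner_smul_right, conj_trivial]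
    ring
  -- Residual of `L f` after its best linear prediction `-M v`. Orthogonality to the data reads `S
  -- (v - u) + ε² v = 0`, which holds because `v - u = -ε² x` and `v = S x`.
  let T : Wbar × (W₂ → ℝ) → ℝ := fun z => L z.1 + z.2 v
  have hT : Measurable T := (L.continuous.measurable.comp measurable_fst).add
    ((measurable_pi_apply v).comp measurable_snd)
  have hTobs : (fun z : Wbar × Ω => T (z.1, observation A 𝕎 ε z.1 z.2))
      = signalPlusNoise A 𝕎 ε (v - u, v) := by
    ext z
    simp only [T, hL, observation, signalPlusNoise, pairing_apply, inner_sub_right]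
    ring
  have hind := indepFun_signalPlusNoise_observation h hprior A ε (v - u, v) (fun φ => by
    simp only [hvu, map_neg, map_smul, hvS, inner_neg_left, inner_smul_left, conj_trivial]
    ring)
  rw [← hTobs] at hind
  have hlaw := ae_map_bayesPosterior_eq h hε hp hT hind
  rw [hTobs, map_signalPlusNoise h hprior] at hlaw
  filter_upwards [ae_observation_of_ae_zero h hp f₀ hlaw,
    ae_isProbabilityMeasure_and_integrable (prior := prior) h hε hp f₀] with ω hω hpost
  obtain ⟨hprob, hint⟩ := hpost
  set m := observation A 𝕎 ε f₀ ω with hm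
  have mTm : Measurable fun f => T (f, m) := hT.comp measurable_prodMk_right
  have hLint : Integrable (fun f => L f) (bayesPosterior prior p m) := L.integrable_comp hint
  have hmean : L (posteriorMean prior p m) = -m v := by
    have e1 : ∫ f, T (f, m) ∂(bayesPosterior prior p m) = 0 := by
      have := integral_map (μ := bayesPosterior prior p m) mTm.aemeasurable
        (f := fun y : ℝ => y) (by fun_prop)
      rw [← this, hω, integral_id_gaussianReal]
    simp only [T] at e1
    rw [integral_add hLint (integrable_const _), integral_const, probReal_univ, one_smul,
      L.integral_comp_comm hint] at e1
    rw [posteriorMean]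
    linarith
  refine ⟨hmean, ?_⟩
  rw [hmean]
  have e2 : (fun f => ε⁻¹ * (L f - -m v)) = (fun y : ℝ => ε⁻¹ * y) ∘ fun f => T (f, m) := by
    ext f
    simp [T]
  rw [e2, ← Measure.map_map (by fun_prop) mTm, hω,
    gaussianReal_map_const_mul, mul_zero]
  congr 1
  have hnn := inner_forwardCovariance_self_nonneg (μ := prior) A x
  have hs0 : 0 ≤ s := by rw [hs']; positivity
  change _ * s.toNNReal = _
  ext
  rw [NNReal.coe_mul, Real.coe_toNNReal _ hs0, Real.coe_toNNReal _ (by positivity), hs']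
  change ε⁻¹ ^ 2 * _ = _
  field_simp

end Posterior

/-! ### Vanishing of bias and noise in the centring -/

section Bias

variable {Wbar W₂ : Type*} [NormedAddCommGroup Wbar] [InnerProductSpace ℝ Wbar]
  [CompleteSpace Wbar] [TopologicalSpace.SeparableSpace Wbar] [MeasurableSpace Wbar]
  [BorelSpace Wbar] [NormedAddCommGroup W₂] [InnerProductSpace ℝ W₂] [CompleteSpace W₂]
  {prior : Measure Wbar} [IsGaussian prior] {A : Wbar →L[ℝ] W₂}

/-- Split `f₀ = g - (g - f₀)` with `g` in the RKHS, of norm at most `2 δ / ε` and within `δ / (2 c)`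
of `f₀`. The first part costs `ε * (2 δ / ε) * K`, the second `(δ / 2) * ε ‖x‖`; together at most `3
K δ`. -/
lemma tendsto_bias {c : ℝ} (hc : 0 < c) (hAc : ∀ f, ‖A f‖ ≤ c * ‖f‖) {f₀ : Wbar}
    (hconc : ConcentrationCondition prior f₀ c) {K : ℝ} {x : ℝ → W₂}
    (hx : ∀ ε > 0, √⟪forwardCovariance prior A (x ε), x ε⟫ ≤ K ∧ ε * ‖x ε‖ ≤ K) :
    Tendsto (fun ε => ε * ⟪A f₀, x ε⟫) (𝓝[>] 0) (𝓝 0) := by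
  obtain ⟨δ, hδ, hδε, hev⟩ := hconc
  have hlim : Tendsto (fun ε => 3 * K * δ ε) (𝓝[>] 0) (𝓝 0) := by
    simpa using hδ.const_mul (3 * K)
  refine squeeze_zero_norm' ?_ hlim
  filter_upwards [hev, hδε.eventually_gt_atTop 0, self_mem_nhdsWithin] with ε h1 h2 hε
  have hε : 0 < ε := hε
  have hδpos : 0 < δ ε := by
    have := mul_pos h2 hε
    rwa [div_mul_cancel₀ _ hε.ne'] at this
  obtain ⟨hx1, hx2⟩ := hx ε hε
  have hK : 0 ≤ K := (Real.sqrt_nonneg _).trans hx1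
  obtain ⟨g, hg, hgδ, hgn⟩ := exists_mem_rkhs_of_concentrationFunction_le h2 h1
  have b1 : |⟪A g, x ε⟫| ≤ 2 * (δ ε / ε) * K :=
    (abs_inner_le_of_mem_rkhs A hg (x ε)).trans
      (mul_le_mul hgn hx1 (Real.sqrt_nonneg _) (by positivity))
  have b2 : |⟪A (g - f₀), x ε⟫| ≤ δ ε / 2 * ‖x ε‖ := by
    refine (abs_real_inner_le_norm _ _).trans (mul_le_mul_of_nonneg_right ?_ (norm_nonneg _))
    refine ((hAc _).trans (mul_le_mul_of_nonneg_left hgδ hc.le)).trans (le_of_eq ?_)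
    field_simp
  have e : ⟪A f₀, x ε⟫ = ⟪A g, x ε⟫ - ⟪A (g - f₀), x ε⟫ := by
    rw [map_sub, inner_sub_left]; ring
  rw [Real.norm_eq_abs, abs_mul, abs_of_pos hε, e]
  calc ε * |⟪A g, x ε⟫ - ⟪A (g - f₀), x ε⟫|
      ≤ ε * (2 * (δ ε / ε) * K + δ ε / 2 * ‖x ε‖) :=
        mul_le_mul_of_nonneg_left ((abs_sub _ _).trans (add_le_add b1 b2)) hε.le
    _ = 2 * K * δ ε + δ ε / 2 * (ε * ‖x ε‖) := by field_simp
    _ ≤ 2 * K * δ ε + δ ε / 2 * K := by gcongr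
    _ ≤ 3 * K * δ ε := by nlinarith [mul_nonneg hK hδpos.le]

end Bias

lemma tendsto_noise {H Ω : Type*} [NormedAddCommGroup H] [InnerProductSpace ℝ H]
    [MeasurableSpace Ω] {P : Measure Ω} [IsProbabilityMeasure P] {𝕎 : H → Ω → ℝ}
    (h : IsWhiteNoise 𝕎 P) {l : Filter ℝ} {b : ℝ → ℝ} (hb : Tendsto b l (𝓝 0)) {v : ℝ → H} {u : H}
    (hv : Tendsto v l (𝓝 u)) :
    TendstoInMeasure P (fun ε ω => b ε + (𝕎 u ω - 𝕎 (v ε) ω)) l (fun _ => 0) := by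
  have m1 (ε : ℝ) : Measurable fun ω => 𝕎 u ω - 𝕎 (v ε) ω :=
    (h.measurable u).sub (h.measurable _)
  refine tendstoInMeasure_of_tendsto_eLpNorm (p := 2) (by norm_num)
    (fun ε => ((m1 ε).const_add _).aestronglyMeasurable) aestronglyMeasurable_const ?_
  have e1 (ε : ℝ) : eLpNorm (fun ω => 𝕎 u ω - 𝕎 (v ε) ω) 2 P = ENNReal.ofReal ‖u - v ε‖ := by
    rw [eLpNorm_eq_lintegral_rpow_enorm_toReal (by norm_num) (by norm_num)]
    have e2 : ∫⁻ ω, ‖𝕎 u ω - 𝕎 (v ε) ω‖ₑ ^ (2 : ℝ≥0∞).toReal ∂P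
        = ENNReal.ofReal (‖u - v ε‖ ^ 2) := by
      rw [← h.lintegral_sub_sq]
      refine lintegral_congr fun ω => ?_
      rw [ENNReal.toReal_ofNat, ENNReal.rpow_ofNat, Real.enorm_eq_ofReal_abs,
        ← ENNReal.ofReal_pow (abs_nonneg _), sq_abs]
    rw [e2, ENNReal.ofReal_pow (norm_nonneg _), ← ENNReal.rpow_natCast, ← ENNReal.rpow_mul]
    simp
  have hbound (ε : ℝ) : eLpNorm ((fun ω => b ε + (𝕎 u ω - 𝕎 (v ε) ω)) - fun _ => (0 : ℝ)) 2 P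
      ≤ ENNReal.ofReal |b ε| + ENNReal.ofReal ‖u - v ε‖ := by
    have e3 : ((fun ω => b ε + (𝕎 u ω - 𝕎 (v ε) ω)) - fun _ => (0 : ℝ))
        = (fun _ => b ε) + fun ω => 𝕎 u ω - 𝕎 (v ε) ω := by ext; simp
    rw [e3, ← e1]
    refine (eLpNorm_add_le aestronglyMeasurable_const (m1 ε).aestronglyMeasurable
      (by norm_num)).trans (add_le_add ?_ le_rfl)
    rw [eLpNorm_const _ (by norm_num) (IsProbabilityMeasure.ne_zero P), measure_univ,
      ENNReal.one_rpow, mul_one, Real.enorm_eq_ofReal_abs]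
  refine tendsto_of_tendsto_of_tendsto_of_le_of_le tendsto_const_nhds ?_ (fun _ => bot_le) hbound
  have t1 : Tendsto (fun ε => ENNReal.ofReal |b ε|) l (𝓝 0) := by
    simpa using ENNReal.tendsto_ofReal hb.abs
  have t2 : Tendsto (fun ε => ENNReal.ofReal ‖u - v ε‖) l (𝓝 0) := by
    simpa using ENNReal.tendsto_ofReal (hv.const_sub u).norm
  simpa using t1.add t2

/-- By the source condition both sides agree on the dense image of `W₁`, and continuous extensions
are unique. -/
lemma extendedPairing_eq {W₁ W₂ Wbar : Type*}
    [NormedAddCommGroup W₁] [InnerProductSpace ℝ W₁] [CompleteSpace W₁]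
    [NormedAddCommGroup W₂] [InnerProductSpace ℝ W₂] [CompleteSpace W₂]
    [NormedAddCommGroup Wbar] [InnerProductSpace ℝ Wbar]
    {A : W₁ →L[ℝ] W₂} {ι : W₁ →ₗ[ℝ] Wbar} (hι_dense : DenseRange ι)
    {Abar : Wbar →L[ℝ] W₂} (hAbar : ∀ φ, Abar (ι φ) = A φ)
    {ψ : W₁} (hψ : ∃ C : ℝ, ∀ φ, |⟪ψ, φ⟫| ≤ C * ‖ι φ‖)
    {ψt : Wbar} (hsource : ψ = -(ContinuousLinearMap.adjoint A) (Abar ψt)) (f : Wbar) :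
    extendedPairing ι ψ f = -⟪Abar f, Abar ψt⟫ := by
  obtain ⟨C, hC⟩ := hψ
  have := LinearMap.extendOfNorm_unique (f := (innerSL ℝ ψ).toLinearMap) (e := ι) hι_dense C hC
    (-(innerSL ℝ (Abar ψt) ∘L Abar)) (by
      ext φ
      simp [hsource, hAbar, ContinuousLinearMap.adjoint_inner_left])
  rw [extendedPairing, this]
  simp [real_inner_comm]

end LinearInverseProblem

end

/-! ### Assembly of the theorem -/

theorem mainTheorem5
    {W₁ W₂ Wbar : Type*}
    [NormedAddCommGroup W₁] [InnerProductSpace ℝ W₁] [CompleteSpace W₁]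
    [TopologicalSpace.SeparableSpace W₁]
    [NormedAddCommGroup W₂] [InnerProductSpace ℝ W₂] [CompleteSpace W₂]
    [TopologicalSpace.SeparableSpace W₂]
    [NormedAddCommGroup Wbar] [InnerProductSpace ℝ Wbar] [CompleteSpace Wbar]
    [TopologicalSpace.SeparableSpace Wbar] [MeasurableSpace Wbar] [BorelSpace Wbar]
    -- the forward operator, the dense inclusion of `W₁` in `Wbar`, and the operator on `Wbar`
    (A : W₁ →L[ℝ] W₂) (hA : Function.Injective A)
    (ι : W₁ →ₗ[ℝ] Wbar) (hι : Function.Injective ι) (hι_dense : DenseRange ι)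
    (Abar : Wbar →L[ℝ] W₂) (hAbar : ∀ φ, Abar (ι φ) = A φ)
    (c : ℝ) (hc : 0 < c) (hAc : ∀ f, ‖Abar f‖ ≤ c * ‖f‖)
    -- the noise
    {Ω : Type*} [MeasurableSpace Ω] (P : Measure Ω) [IsProbabilityMeasure P]
    (𝕎 : W₂ → Ω → ℝ) (h𝕎 : LinearInverseProblem.IsWhiteNoise 𝕎 P)
    -- the prior and the true parameter
    (prior : Measure Wbar) [IsGaussian prior] (hprior : ∫ f, f ∂prior = 0)
    (f₀ : Wbar) (hconc : LinearInverseProblem.ConcentrationCondition prior f₀ c)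
    -- the test function
    (ψ : W₁) (hψ : ∃ C : ℝ, ∀ φ, |⟪ψ, φ⟫| ≤ C * ‖ι φ‖)
    (ψt : Wbar) (hψt : ψt ∈ LinearInverseProblem.rkhs prior)
    (hsource : ψ = -(ContinuousLinearMap.adjoint A) (Abar ψt)) :
    -- a jointly measurable version of the likelihood exists
    (∀ ε > 0, ∃ p, LinearInverseProblem.IsLikelihood P Abar 𝕎 ε p) ∧
    -- and, whichever version is used,
    ∀ p : ℝ → Wbar → (W₂ → ℝ) → ℝ≥0∞,
      (∀ ε > 0, LinearInverseProblem.IsLikelihood P Abar 𝕎 ε (p ε)) →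
      -- the posterior is a probability measure and has a mean, almost surely,
      (∀ ε > 0, ∀ᵐ ω ∂P,
        IsProbabilityMeasure (LinearInverseProblem.bayesPosterior prior (p ε)
          (LinearInverseProblem.observation Abar 𝕎 ε f₀ ω)) ∧
        Integrable (fun f => f) (LinearInverseProblem.bayesPosterior prior (p ε)
          (LinearInverseProblem.observation Abar 𝕎 ε f₀ ω))) ∧
      -- the posterior mean is asymptotically equivalent to the efficient centring,
      TendstoInMeasure P
        (fun ε ω => ε⁻¹ *
          (LinearInverseProblem.extendedPairing ι ψ
              (LinearInverseProblem.posteriorMean prior (p ε)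
                (LinearInverseProblem.observation Abar 𝕎 ε f₀ ω))
            - (LinearInverseProblem.extendedPairing ι ψ f₀ - ε * 𝕎 (Abar ψt) ω)))
        (𝓝[>] 0) (fun _ => 0) ∧
      -- and the Bernstein-von Mises theorem holds with centring at the posterior mean
      LinearInverseProblem.TendstoWeaklyInProbability P
        (fun ε ω =>
          (LinearInverseProblem.bayesPosterior prior (p ε)
            (LinearInverseProblem.observation Abar 𝕎 ε f₀ ω)).map
          (fun f => ε⁻¹ *
            (LinearInverseProblem.extendedPairing ι ψ f
              - LinearInverseProblem.extendedPairing ι ψ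
                  (LinearInverseProblem.posteriorMean prior (p ε)
                    (LinearInverseProblem.observation Abar 𝕎 ε f₀ ω)))))
        (𝓝[>] 0)
        (⟨gaussianReal 0 (‖Abar ψt‖₊ ^ 2), inferInstance⟩ : ProbabilityMeasure ℝ) := by
  refine ⟨fun ε hε => ?_, fun p hp => ?_⟩
  · obtain ⟨q, hq, -⟩ := LinearInverseProblem.exists_isLikelihood h𝕎 Abar hε
    exact ⟨q, hq⟩
  set L := LinearInverseProblem.extendedPairing ι ψ
  set u := Abar ψt
  set S := LinearInverseProblem.forwardCovariance prior Abar
  have hL (f : Wbar) : L f = -⟪Abar f, u⟫ :=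
    LinearInverseProblem.extendedPairing_eq hι_dense hAbar hψ hsource f
  have hSnn (y : W₂) : 0 ≤ ⟪S y, y⟫ :=
    LinearInverseProblem.inner_forwardCovariance_self_nonneg Abar y
  -- A value for every real `ε` is needed to choose a function; for `ε ≤ 0` it is a dummy.
  have hres (ε : ℝ) : ∃ x, 0 < ε → S x + ε ^ 2 • x = u := by
    by_cases hε : 0 < ε
    · obtain ⟨x, hx⟩ := LinearInverseProblem.exists_resolvent S hSnn hε u
      exact ⟨x, fun _ => hx⟩
    · exact ⟨0, fun h => absurd h hε⟩
  choose x hx using hres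
  set K := (LinearInverseProblem.rkhsNorm prior ψt).toReal
  have hbd (ε : ℝ) (hε : ε > 0) : √⟪S (x ε), x ε⟫ ≤ K ∧ ε * ‖x ε‖ ≤ K :=
    LinearInverseProblem.resolvent_bounds hSnn hε ENNReal.toReal_nonneg (hx ε hε)
      (LinearInverseProblem.abs_inner_le_of_mem_rkhs Abar hψt (x ε))
  have hKε : Tendsto (fun ε : ℝ => ε * K) (𝓝[>] 0) (𝓝 0) := by
    have : Tendsto (fun ε : ℝ => ε * K) (𝓝 0) (𝓝 (0 * K)) :=
      (continuous_id.mul continuous_const).tendsto 0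
    rw [zero_mul] at this
    exact this.mono_left nhdsWithin_le_nhds
  have hpert : Tendsto (fun ε => ε ^ 2 • x ε) (𝓝[>] 0) (𝓝 0) := by
    refine squeeze_zero_norm' ?_ hKε
    filter_upwards [self_mem_nhdsWithin] with ε hε
    have hε : 0 < ε := hε
    rw [norm_smul, Real.norm_eq_abs, abs_of_pos (by positivity), sq, mul_assoc]
    exact mul_le_mul_of_nonneg_left (hbd ε hε).2 hε.le
  have hv : Tendsto (fun ε => u - ε ^ 2 • x ε) (𝓝[>] 0) (𝓝 u) := by
    simpa using hpert.const_sub u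
  have hbias := LinearInverseProblem.tendsto_bias hc hAc hconc hbd
  have hpost (ε : ℝ) (hε : 0 < ε) := LinearInverseProblem.ae_posterior_functional h𝕎 hprior hε
    (hp ε hε) f₀ (hx ε hε) hL
  refine ⟨fun ε hε => LinearInverseProblem.ae_isProbabilityMeasure_and_integrable h𝕎 hε
    (hp ε hε) f₀, ?_, ?_⟩
  -- Inserting the posterior mean `-M v`, the rescaled centring error equals `ε ⟪A f₀, x⟫ + (𝕎 u - 𝕎
  -- v)`, with no linearity of `𝕎` needed.
  · refine (LinearInverseProblem.tendsto_noise h𝕎 hbias hv).congr' ?_ EventuallyEq.rfl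
    filter_upwards [self_mem_nhdsWithin] with ε hε
    have hε : 0 < ε := hε
    filter_upwards [hpost ε hε] with ω hω
    rw [hω.1, hL f₀]
    simp only [LinearInverseProblem.observation, inner_sub_right, inner_smul_right]
    field_simp
    ring
  · have hvar : Tendsto (fun ε => (ε ^ 2 * ⟪S (x ε), x ε⟫ + ‖u - ε ^ 2 • x ε‖ ^ 2).toNNReal)
        (𝓝[>] 0) (𝓝 (‖u‖₊ ^ 2)) := by
      have h1 : Tendsto (fun ε => ε ^ 2 * ⟪S (x ε), x ε⟫) (𝓝[>] 0) (𝓝 0) := by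
        have h2 : Tendsto (fun ε : ℝ => (ε * K) ^ 2) (𝓝[>] 0) (𝓝 0) := by
          simpa using hKε.pow 2
        refine squeeze_zero' (Eventually.of_forall fun ε => mul_nonneg (sq_nonneg _) (hSnn _)) ?_ h2
        filter_upwards [self_mem_nhdsWithin] with ε hε
        rw [mul_pow]
        refine mul_le_mul_of_nonneg_left ?_ (sq_nonneg _)
        exact (Real.sqrt_le_left ENNReal.toReal_nonneg).1 (hbd ε hε).1
      have h3 := (continuous_real_toNNReal.tendsto _).comp (h1.add (hv.norm.pow 2))
      have e : (0 + ‖u‖ ^ 2).toNNReal = ‖u‖₊ ^ 2 := by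
        rw [zero_add, Real.toNNReal_pow (norm_nonneg _), norm_toNNReal]
      rwa [e] at h3
    refine LinearInverseProblem.tendstoWeaklyInProbability_of_ae_eq
      ((LinearInverseProblem.continuous_centredGaussian.tendsto _).comp hvar) ?_
    filter_upwards [self_mem_nhdsWithin] with ε hε
    filter_upwards [hpost ε hε] with ω hω
    exact hω.2
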